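/- Let $(\Sigma,g)$ be a closed connected smooth Riemannian surface of total area $1$, with Riemannian distance $d$ and area measure $dV_g$; let $h_1,h_2\in C^\infty(\Sigma)$ be positive and $\rho=(\rho_1,\rho_2)\in\mathbb R^2$. For $u=(u_1,u_2)\in H^1(\Sigma)^2$ define $$J_{B_2,\rho}(u)=\int_\Sigma\Big(\tfrac{|\nabla u_1|^2}2+\tfrac{\nabla u_1\cdot\nabla u_2}2+\tfrac{|\nabla u_2|^2}4\Big)dV_g-\rho_1\Big(\log\int_\Sigma h_1e^{u_1}dV_g-\int_\Sigma u_1\,dV_g\Big)-\tfrac{\rho_2}2\Big(\log\int_\Sigma h_2e^{u_2}dV_g-\int_\Sigma u_2\,dV_g\Big),$$ $$J_{G_2,\rho}(u)=\int_\Sigma\Big(|\nabla u_1|^2+\nabla u_1\cdot\nabla u_2+\tfrac{|\nabla u_2|^2}3\Big)dV_g-\rho_1\Big(\log\int_\Sigma h_1e^{u_1}dV_g-\int_\Sigma u_1\,dV_g\Big)-\tfrac{\rho_2}3\Big(\log\int_\Sigma h_2e^{u_2}dV_g-\int_\Sigma u_2\,dV_g\Big).$$ For $\gamma\subset\Sigma$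 and $K\in\mathbb N$ let $(\gamma)_K=\{\sum_{k=1}^Kt_k\delta_{x_k}:x_k\in\gamma,\ t_k\ge0,\ \sum_kt_k=1\}$ (which is empty for $K=0$), and let $X\star Y=(X\times Y\times[0,1])/\!\sim$ be the join, where $(x,y,0)\sim(x,y',0)$ and $(x,y,1)\sim(x',y,1)$. **Theorem 3.1.** Let $\gamma_1,\gamma_2\subset\Sigma$ be disjoint compact sets (for instance two disjoint curves, each homeomorphic to a wedge sum of circles), let $K_1,K_2\in\mathbb N$, and let $\rho\in(4K_1\pi,4(K_1+1)\pi)\times(4K_2\pi,4(K_2+1)\pi)$. For $\lambda>0$ and $\zeta=(\sigma_1,\sigma_2,t)=\big(\sum_kt_{1k}\delta_{x_{1k}},\sum_kt_{2k}\delta_{x_{2k}},t\big)\in(\gamma_1)_{K_1}\star(\gamma_2)_{K_2}$ set $$\varphi_1=\log\sum_{k=1}^{K_1}\frac{t_{1k}}{\big(1+(\lambda(1-t)d(\cdot,x_{1k}))^2\big)^2},\qquad\varphi_2=\log\sum_{k=1}^{K_2}\frac{t_{2k}}{\big(1+(\lambda t\,d(\cdot,x_{2k}))^2\big)^2},$$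 $$\Phi^\lambda_{B_2}(\zeta)=\Big(\varphi_1-\frac{\varphi_2}2,\ \varphi_2-\varphi_1\Big),\qquad\Phi^\lambda_{G_2}(\zeta)=\Big(\varphi_1-\frac{\varphi_2}2,\ \varphi_2-\frac32\varphi_1\Big).$$ Then $\Phi^\lambda_{B_2}(\zeta),\Phi^\lambda_{G_2}(\zeta)\in H^1(\Sigma)^2$, and $J_{B_2,\rho}(\Phi^\lambda_{B_2}(\zeta))\to-\infty$ and $J_{G_2,\rho}(\Phi^\lambda_{G_2}(\zeta))\to-\infty$ as $\lambda\to+\infty$, both uniformly in $\zeta\in(\gamma_1)_{K_1}\star(\gamma_2)_{K_2}$. -/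

import Mathlib

open Set Filter Topology MeasureTheory Bundle Manifold
open scoped ContDiff ENNReal

noncomputable section

namespace TodaSurface

/-- The model plane `ℝ²` with its Euclidean norm. -/
abbrev Plane : Type := EuclideanSpace ℝ (Fin 2)

section Riemannian

variable {M : Type*} [MetricSpace M] [ChartedSpace Plane M] [IsManifold (𝓡 2) ∞ M]
  [RiemannianBundle (fun x : M => TangentSpace (𝓡 2) x)]

/-- The point of `M` with coordinates `y` in the chart centred at `p`. -/
def chartPoint (p : M) (y : Plane) : M := (extChartAt (𝓡 2) p).symm y

/-- The vector tangent to `M` at `chartPoint p y` with coordinates `v` in the chart centred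
at `p`, i.e. the derivative of the inverse chart in the direction `v`. -/
def chartVector (p : M) (y v : Plane) : TangentSpace (𝓡 2) (chartPoint p y) :=
  mfderiv 𝓘(ℝ, Plane) (𝓡 2) (chartPoint p) y v

/-- The matrix `(g_{ij})` of the Riemannian metric in the chart centred at `p`. -/
def gramMatrix (p : M) (y : Plane) : Matrix (Fin 2) (Fin 2) ℝ :=
  Matrix.of fun i j =>
    inner ℝ (chartVector p y (EuclideanSpace.single i 1))
      (chartVector p y (EuclideanSpace.single j 1))

/-- The Riemannian area of the domain of the chart centred at `p`: the measure
`√(det g_{ij}) dy` on the chart target, transported to `M`. -/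
def chartArea [MeasurableSpace M] (p : M) : Measure M :=
  ((volume.restrict (extChartAt (𝓡 2) p).target).withDensity
    fun y => ENNReal.ofReal (Real.sqrt (gramMatrix p y).det)).map (chartPoint p)

/-- The Riemannian area measure `dV_g`: the least measure on `M` which dominates
`√(det g_{ij}) dy` in every chart. As these local measures agree on the overlaps of the
charts, it is the measure which is equal to `√(det g_{ij}) dy` in every chart. -/
def area (M : Type*) [MetricSpace M] [ChartedSpace Plane M] [IsManifold (𝓡 2) ∞ M]
    [RiemannianBundle (fun x : M => TangentSpace (𝓡 2) x)] [MeasurableSpace M] : Measure M :=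
  ⨆ p : M, chartArea p

/-- `X` is the weak gradient of `u`: in every chart, `u` and the coordinates
`g(X, ∂_v)` of the differential of `u` are locally integrable, and they satisfy the
integration by parts formula against every smooth function with compact support in the chart. -/
def IsWeakGradient (u : M → ℝ) (X : (x : M) → TangentSpace (𝓡 2) x) : Prop :=
  ∀ p : M,
    LocallyIntegrableOn (fun y => u (chartPoint p y)) (extChartAt (𝓡 2) p).target volume ∧
    ∀ v : Plane,
      LocallyIntegrableOn (fun y => inner ℝ (X (chartPoint p y)) (chartVector p y v))
        (extChartAt (𝓡 2) p).target volume ∧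
      ∀ ψ : Plane → ℝ, ContDiff ℝ ∞ ψ → HasCompactSupport ψ →
        tsupport ψ ⊆ (extChartAt (𝓡 2) p).target →
        ∫ y in (extChartAt (𝓡 2) p).target, u (chartPoint p y) * fderiv ℝ ψ y v =
          -∫ y in (extChartAt (𝓡 2) p).target,
            inner ℝ (X (chartPoint p y)) (chartVector p y v) * ψ y

open Classical in
/-- The weak gradient `∇u` (it is unique almost everywhere; `0` if there is none). -/
def weakGradient (u : M → ℝ) : (x : M) → TangentSpace (𝓡 2) x :=
  if h : ∃ X, IsWeakGradient u X then h.choose else fun _ => 0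

/-- The Sobolev space `H¹(M)`: square integrable functions with a square integrable
weak gradient. -/
def MemH1 [MeasurableSpace M] (u : M → ℝ) : Prop :=
  MemLp u 2 (area M) ∧ ∃ X : (x : M) → TangentSpace (𝓡 2) x,
    IsWeakGradient u X ∧ MemLp (fun x => ‖X x‖) 2 (area M)

/-- `Q_{B₂}(u) = |∇u₁|²/2 + ∇u₁·∇u₂/2 + |∇u₂|²/4`. -/
def QB2 (u : (M → ℝ) × (M → ℝ)) (x : M) : ℝ :=
  ‖weakGradient u.1 x‖ ^ 2 / 2 + inner ℝ (weakGradient u.1 x) (weakGradient u.2 x) / 2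
    + ‖weakGradient u.2 x‖ ^ 2 / 4

/-- `Q_{G₂}(u) = |∇u₁|² + ∇u₁·∇u₂ + |∇u₂|²/3`. -/
def QG2 (u : (M → ℝ) × (M → ℝ)) (x : M) : ℝ :=
  ‖weakGradient u.1 x‖ ^ 2 + inner ℝ (weakGradient u.1 x) (weakGradient u.2 x)
    + ‖weakGradient u.2 x‖ ^ 2 / 3

/-- `log ∫ h e^u dV_g - ∫ u dV_g`. -/
def logTerm [MeasurableSpace M] (h u : M → ℝ) : ℝ :=
  Real.log (∫ x, h x * Real.exp (u x) ∂(area M)) - ∫ x, u x ∂(area M)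

/-- The energy functional `J_{B₂,ρ}`, for the potentials `h = (h₁, h₂)` and the
parameters `ρ = (ρ₁, ρ₂)`. -/
def JB2 [MeasurableSpace M] (h : (M → ℝ) × (M → ℝ)) (ρ : ℝ × ℝ)
    (u : (M → ℝ) × (M → ℝ)) : ℝ :=
  (∫ x, QB2 u x ∂(area M)) - ρ.1 * logTerm h.1 u.1 - ρ.2 / 2 * logTerm h.2 u.2

/-- The energy functional `J_{G₂,ρ}`, for the potentials `h = (h₁, h₂)` and the
parameters `ρ = (ρ₁, ρ₂)`. -/
def JG2 [MeasurableSpace M] (h : (M → ℝ) × (M → ℝ)) (ρ : ℝ × ℝ)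
    (u : (M → ℝ) × (M → ℝ)) : ℝ :=
  (∫ x, QG2 u x ∂(area M)) - ρ.1 * logTerm h.1 u.1 - ρ.2 / 3 * logTerm h.2 u.2

end Riemannian

section Join

/-- One step of the identifications on `X × Y × [0, 1]` which define the join. -/
inductive JoinRel (X Y : Type*) : X × Y × unitInterval → X × Y × unitInterval → Prop
  | collapse_right (x : X) (y y' : Y) : JoinRel X Y (x, y, 0) (x, y', 0)
  | collapse_left (x x' : X) (y : Y) : JoinRel X Y (x, y, 1) (x', y, 1)

/-- The join `X ⋆ Y`: the quotient of `X × Y × [0, 1]` by the equivalence relation generated by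
`(x, y, 0) ∼ (x, y', 0)` and `(x, y, 1) ∼ (x', y, 1)`. -/
def Join (X Y : Type*) : Type _ := Quot (JoinRel X Y)

end Join

section Bubbles

variable {M : Type*} [MetricSpace M] [MeasurableSpace M]

/-- The barycenters `(γ)_K`: the probability measures supported in at most `K` points of `γ`. -/
def barycenters (γ : Set M) (K : ℕ) : Set (Measure M) :=
  {σ | ∃ (t : Fin K → ℝ) (x : Fin K → M), (∀ k, 0 ≤ t k) ∧ (∀ k, x k ∈ γ) ∧ ∑ k, t k = 1 ∧
    σ = ∑ k, ENNReal.ofReal (t k) • Measure.dirac (x k)}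

/-- The bubble `log ∫ (1 + (r d(·, y))²)⁻² dσ(y)`. For `σ = ∑ t_k δ_{x_k}` this is
`log ∑ t_k / (1 + (r d(·, x_k))²)²`, see `bubble_sum_dirac`. -/
def bubble (r : ℝ) (σ : Measure M) (x : M) : ℝ :=
  Real.log (∫ y, 1 / (1 + (r * dist x y) ^ 2) ^ 2 ∂σ)

theorem bubble_sum_dirac [BorelSpace M] {K : ℕ} (r : ℝ) (t : Fin K → ℝ) (x : Fin K → M)
    (ht : ∀ k, 0 ≤ t k) (z : M) :
    bubble r (∑ k, ENNReal.ofReal (t k) • Measure.dirac (x k)) z =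
      Real.log (∑ k, t k / (1 + (r * dist z (x k)) ^ 2) ^ 2) := by
  unfold bubble
  rw [integral_finsetSum_measure]
  · congr 1
    refine Finset.sum_congr rfl fun k _ => ?_
    rw [integral_smul_measure, integral_dirac, ENNReal.toReal_ofReal (ht k), smul_eq_mul,
      mul_one_div]
  · intro k _
    exact (integrable_dirac (by simp)).smul_measure ENNReal.ofReal_ne_top

theorem bubble_zero [BorelSpace M] {γ : Set M} {K : ℕ} (σ : barycenters γ K) :
    bubble 0 (σ : Measure M) = fun _ => 0 := by
  obtain ⟨σ, t, x, ht, hx, hsum, rfl⟩ := σ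
  funext z
  rw [bubble_sum_dirac 0 t x ht z]
  simp [hsum]

variable [BorelSpace M] {γ₁ γ₂ : Set M} {K₁ K₂ : ℕ}

/-- `φ₁^λ(σ₁, σ₂, t) = log ∑ t_{1k} / (1 + (λ (1 - t) d(·, x_{1k}))²)²` on the join. -/
def phi₁ (lam : ℝ) (ζ : Join (barycenters γ₁ K₁) (barycenters γ₂ K₂)) : M → ℝ :=
  Quot.lift (fun q : barycenters γ₁ K₁ × barycenters γ₂ K₂ × unitInterval =>
      bubble (lam * (1 - (q.2.2 : ℝ))) (q.1 : Measure M))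
    (by
      rintro _ _ (⟨x, y, y'⟩ | ⟨x, x', y⟩)
      · rfl
      · simp [bubble_zero]) ζ

/-- `φ₂^λ(σ₁, σ₂, t) = log ∑ t_{2k} / (1 + (λ t d(·, x_{2k}))²)²` on the join. -/
def phi₂ (lam : ℝ) (ζ : Join (barycenters γ₁ K₁) (barycenters γ₂ K₂)) : M → ℝ :=
  Quot.lift (fun q : barycenters γ₁ K₁ × barycenters γ₂ K₂ × unitInterval =>
      bubble (lam * (q.2.2 : ℝ)) (q.2.1 : Measure M))
    (by
      rintro _ _ (⟨x, y, y'⟩ | ⟨x, x', y⟩)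
      · simp [bubble_zero]
      · rfl) ζ

/-- `Φ_{B₂}^λ(ζ) = (φ₁ - φ₂/2, φ₂ - φ₁)`. -/
def PhiB2 (lam : ℝ) (ζ : Join (barycenters γ₁ K₁) (barycenters γ₂ K₂)) :
    (M → ℝ) × (M → ℝ) :=
  (fun x => phi₁ lam ζ x - phi₂ lam ζ x / 2, fun x => phi₂ lam ζ x - phi₁ lam ζ x)

/-- `Φ_{G₂}^λ(ζ) = (φ₁ - φ₂/2, φ₂ - (3/2) φ₁)`. -/
def PhiG2 (lam : ℝ) (ζ : Join (barycenters γ₁ K₁) (barycenters γ₂ K₂)) :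
    (M → ℝ) × (M → ℝ) :=
  (fun x => phi₁ lam ζ x - phi₂ lam ζ x / 2, fun x => phi₂ lam ζ x - 3 / 2 * phi₁ lam ζ x)

end Bubbles

end TodaSurface

end

/-!
Near each point a chart is, after a linear change of coordinates, an isometry up to a factor `κ`
arbitrarily close to `1`, for distances as well as for areas. As the surface is compact, all discs
of small radius `s` have area between `κ⁻³πs²` and `κ³πs²` (`exists_radius_area_ball_bounds`), and
this is the only geometric input of the estimates. By the layer cake formula the area bound `A s²`,
with `A = κ³π`, gives that the integral of `d(·, x)⁻²` truncated at distance `1/L` is at most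
`2A log L + C`, and that the integral of `d(·, x)⁻¹` is bounded. Inverse distances are always
truncated, as `(max L⁻¹ d)⁻¹`: this keeps them continuous and avoids the value `0⁻¹ = 0` at the
centre.

The functions `φ₁`, `φ₂` are Lipschitz (`logBubble`). By Rademacher's theorem in charts a Lipschitz
function has a pointwise gradient almost everywhere, this is its weak gradient, and weak gradients
are unique (`isWeakGradient_grad`, `IsWeakGradient.ae_eq`). So the test functions are in `H¹`, and
the energy can be computed pointwise: in both cases it is
`|∇φ₁|²/4 - ∇φ₁·∇φ₂/4 + β|∇φ₂|²`, with `β = 1/8` for `B₂` and `β = 1/12` for `G₂`. Write `L₁`, `L₂`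
for `max 1 (λ(1 - t))` and `max 1 (λt)`.

* The slope of `φᵢ` is at most the largest of the slopes of its terms, hence at most the largest of
  the `4 / max (1/Lᵢ) (d(·, xₖ))`, so `∫ |∇φᵢ|² ≤ 32 Kᵢ A log Lᵢ + C`.
* The mixed term is bounded, because the centres of `φ₁` and `φ₂` lie in disjoint compact sets: at
  each point one of the gradients is bounded, and the other one is at most a sum of inverse
  distances (`exists_integral_le_of_le_grad`).
* The mean of `φᵢ` is `-4 log Lᵢ` up to a constant. Near a centre of `φᵢ` of weight at least `1/Kᵢ`,
  on a disc of radius of order `1/Lᵢ`, `exp φᵢ` is bounded below while the other function is at most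
  its mean plus a constant, so each logarithmic term is at least `2 log Lᵢ - C`
  (`exists_le_logTerm`).

Together (`exists_JB2_le`, `exists_JG2_le`),
`J ≤ 2 (4 K₁ A - ρ₁) log L₁ + c (4 K₂ A - ρ₂) log L₂ + C` with `c = 1` or `c = 2/3`. As
`ρᵢ > 4 Kᵢ π`, both coefficients are negative once `κ` is close to `1`; and at least one of
`λ(1 - t)` and `λt` is at least `λ/2`, uniformly on the join.
-/

noncomputable section

namespace TodaSurface

open scoped NNReal

set_option linter.unusedSectionVars false

/-! ### Charts and Gram matrices -/

section Geometry

variable {M : Type*} [MetricSpace M] [ChartedSpace Plane M]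

lemma chartPoint_mem_source {p : M} {y : Plane} (hy : y ∈ (extChartAt (𝓡 2) p).target) :
    chartPoint p y ∈ (extChartAt (𝓡 2) p).source :=
  (extChartAt (𝓡 2) p).map_target hy

lemma extChartAt_chartPoint {p : M} {y : Plane} (hy : y ∈ (extChartAt (𝓡 2) p).target) :
    extChartAt (𝓡 2) p (chartPoint p y) = y :=
  (extChartAt (𝓡 2) p).right_inv hy

lemma chartPoint_extChartAt {p x : M} (hx : x ∈ (extChartAt (𝓡 2) p).source) :
    chartPoint p (extChartAt (𝓡 2) p x) = x :=
  (extChartAt (𝓡 2) p).left_inv hx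

lemma continuousOn_chartPoint (p : M) :
    ContinuousOn (chartPoint p) (extChartAt (𝓡 2) p).target :=
  continuousOn_extChartAt_symm p

variable [IsManifold (𝓡 2) ∞ M]

lemma contMDiffOn_chartPoint (p : M) :
    ContMDiffOn 𝓘(ℝ, Plane) (𝓡 2) ∞ (chartPoint p) (extChartAt (𝓡 2) p).target :=
  contMDiffOn_extChartAt_symm p

lemma mdifferentiableAt_chartPoint {p : M} {y : Plane}
    (hy : y ∈ (extChartAt (𝓡 2) p).target) :
    MDifferentiableAt 𝓘(ℝ, Plane) (𝓡 2) (chartPoint p) y :=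
  ((contMDiffOn_chartPoint p).contMDiffAt
    ((isOpen_extChartAt_target p).mem_nhds hy)).mdifferentiableAt (by simp)

lemma mdifferentiableAt_extChartAt_of_mem {p x : M} (hx : x ∈ (extChartAt (𝓡 2) p).source) :
    MDifferentiableAt (𝓡 2) 𝓘(ℝ, Plane) (extChartAt (𝓡 2) p) x :=
  mdifferentiableAt_extChartAt (by simpa using hx)

/-- The derivative of the inverse chart centred at `p`, as a continuous linear map: it sends `v` to
`chartVector p y v`. -/
def chartDeriv (p : M) (y : Plane) : Plane →L[ℝ] TangentSpace (𝓡 2) (chartPoint p y) :=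
  mfderiv 𝓘(ℝ, Plane) (𝓡 2) (chartPoint p) y

lemma mfderiv_extChartAt_chartDeriv {p : M} {y : Plane}
    (hy : y ∈ (extChartAt (𝓡 2) p).target) (v : Plane) :
    mfderiv (𝓡 2) 𝓘(ℝ, Plane) (extChartAt (𝓡 2) p) (chartPoint p y) (chartDeriv p y v) = v := by
  have h1 : HasMFDerivAt 𝓘(ℝ, Plane) 𝓘(ℝ, Plane) (extChartAt (𝓡 2) p ∘ chartPoint p) y _ :=
    (mdifferentiableAt_extChartAt_of_mem (chartPoint_mem_source hy)).hasMFDerivAt.comp y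
    (mdifferentiableAt_chartPoint hy).hasMFDerivAt
  have h2 : HasMFDerivAt 𝓘(ℝ, Plane) 𝓘(ℝ, Plane) (extChartAt (𝓡 2) p ∘ chartPoint p) y
      (ContinuousLinearMap.id ℝ Plane) := by
    refine (hasMFDerivAt_id y).congr_of_eventuallyEq ?_
    filter_upwards [(isOpen_extChartAt_target (I := 𝓡 2) p).mem_nhds hy] with z hz
    exact extChartAt_chartPoint hz
  exact congr($(hasMFDerivAt_unique h1 h2) v)

lemma chartDeriv_mfderiv_extChartAt {p : M} {y : Plane}
    (hy : y ∈ (extChartAt (𝓡 2) p).target) (w : TangentSpace (𝓡 2) (chartPoint p y)) :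
    chartDeriv p y (mfderiv (𝓡 2) 𝓘(ℝ, Plane) (extChartAt (𝓡 2) p) (chartPoint p y) w) = w := by
  have hx := chartPoint_mem_source hy
  have h0 : HasMFDerivAt 𝓘(ℝ, Plane) (𝓡 2) (chartPoint p)
    (extChartAt (𝓡 2) p (chartPoint p y)) (chartDeriv p y) := by
      rw [extChartAt_chartPoint hy]
      exact (mdifferentiableAt_chartPoint hy).hasMFDerivAt
  have h1 : HasMFDerivAt (𝓡 2) (𝓡 2) (chartPoint p ∘ extChartAt (𝓡 2) p) (chartPoint p y) _ :=
    h0.comp _ (mdifferentiableAt_extChartAt_of_mem hx).hasMFDerivAt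
  have h2 : HasMFDerivAt (𝓡 2) (𝓡 2) (chartPoint p ∘ extChartAt (𝓡 2) p) (chartPoint p y)
      (ContinuousLinearMap.id ℝ (TangentSpace (𝓡 2) (chartPoint p y))) := by
    refine (hasMFDerivAt_id (chartPoint p y)).congr_of_eventuallyEq ?_
    filter_upwards [(isOpen_extChartAt_source (I := 𝓡 2) p).mem_nhds hx] with z hz
    exact chartPoint_extChartAt hz
  exact congr($(hasMFDerivAt_unique h1 h2) w)

variable [RiemannianBundle (fun x : M => TangentSpace (𝓡 2) x)]

lemma chartVector_add (p : M) (y v w : Plane) :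
    chartVector p y (v + w) = chartVector p y v + chartVector p y w :=
  map_add (chartDeriv p y) v w

lemma chartVector_smul (p : M) (y : Plane) (c : ℝ) (v : Plane) :
    chartVector p y (c • v) = c • chartVector p y v :=
  map_smul (chartDeriv p y) c v

lemma chartVector_mfderiv {p : M} {y : Plane}
    (hy : y ∈ (extChartAt (𝓡 2) p).target) (w : TangentSpace (𝓡 2) (chartPoint p y)) :
    chartVector p y (mfderiv (𝓡 2) 𝓘(ℝ, Plane) (extChartAt (𝓡 2) p) (chartPoint p y) w) = w :=
  chartDeriv_mfderiv_extChartAt hy w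

/-- In every chart the Riemannian metric at a point is the pull-back of the Euclidean one by a
linear isomorphism `A` of the plane. -/
lemma exists_linear_isometry_frame {p : M} {y : Plane} (hy : y ∈ (extChartAt (𝓡 2) p).target) :
    ∃ A : Plane ≃L[ℝ] Plane, ∀ v w : Plane,
      inner ℝ (A v) (A w) = inner ℝ (chartVector p y v) (chartVector p y w) := by
  let T := TangentSpace (𝓡 2) (chartPoint p y)
  let e : Plane ≃ₗ[ℝ] T := LinearEquiv.ofBijective (chartDeriv p y : Plane →ₗ[ℝ] T)
    ⟨fun v w h => by
      have := mfderiv_extChartAt_chartDeriv hy v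
      have h2 := mfderiv_extChartAt_chartDeriv hy w
      simp only [ContinuousLinearMap.coe_coe] at h
      rw [h] at this
      exact this.symm.trans h2, fun w => ⟨_, chartDeriv_mfderiv_extChartAt hy w⟩⟩
  have hfin : FiniteDimensional ℝ T := e.finiteDimensional
  have hrank : Module.finrank ℝ T = 2 := by
    rw [← e.finrank_eq]; simp
  let b := (stdOrthonormalBasis ℝ T).reindex (finCongr hrank)
  refine ⟨(e.trans b.repr.toLinearEquiv).toContinuousLinearEquiv, fun v w => ?_⟩
  exact b.repr.inner_map_map _ _

lemma det_gramMatrix_eq {p : M} {y : Plane} {A : Plane →L[ℝ] Plane}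
    (hA : ∀ v w : Plane,
      inner ℝ (A v) (A w) = inner ℝ (chartVector p y v) (chartVector p y w)) :
    (gramMatrix p y).det = A.det ^ 2 := by
  let b := (EuclideanSpace.basisFun (Fin 2) ℝ).toBasis
  let m := LinearMap.toMatrix b b (A : Plane →ₗ[ℝ] Plane)
  have h1 : gramMatrix p y = m.transpose * m := by
    ext i j
    simp only [gramMatrix, Matrix.of_apply, ← hA, Matrix.mul_apply, Matrix.transpose_apply, m,
      LinearMap.toMatrix_apply]
    simp [b, PiLp.inner_apply, mul_comm]
  have h2 : m.det = A.det := LinearMap.det_toMatrix b _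
  rw [h1, Matrix.det_mul, Matrix.det_transpose, h2, sq]

/-- The area density is the Jacobian of the linear map which represents the metric. -/
lemma sqrt_det_gramMatrix_eq {p : M} {y : Plane} {A : Plane →L[ℝ] Plane}
    (hA : ∀ v w : Plane,
      inner ℝ (A v) (A w) = inner ℝ (chartVector p y v) (chartVector p y w)) :
    Real.sqrt (gramMatrix p y).det = |A.det| := by
  rw [det_gramMatrix_eq hA, Real.sqrt_sq_eq_abs]

lemma det_gramMatrix_pos {p : M} {y : Plane} (hy : y ∈ (extChartAt (𝓡 2) p).target) :
    0 < (gramMatrix p y).det := by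
  obtain ⟨A, hA⟩ := exists_linear_isometry_frame hy
  rw [det_gramMatrix_eq (A := (A : Plane →L[ℝ] Plane)) hA]
  have : (A : Plane →L[ℝ] Plane).det ≠ 0 := A.toLinearEquiv.isUnit_det'.ne_zero
  positivity

lemma norm_chartVector_sq (p : M) (y v : Plane) :
    ‖chartVector p y v‖ ^ 2 = v 0 ^ 2 * gramMatrix p y 0 0 + 2 * (v 0 * v 1) * gramMatrix p y 0 1
      + v 1 ^ 2 * gramMatrix p y 1 1 := by
  have hv : v = v 0 • EuclideanSpace.single 0 1 + v 1 • EuclideanSpace.single 1 1 := by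
    ext i; fin_cases i <;> simp
  conv_lhs => rw [hv]
  rw [chartVector_add, chartVector_smul, chartVector_smul, norm_add_sq_real, norm_smul, norm_smul,
    real_inner_smul_left, real_inner_smul_right, mul_pow, mul_pow, Real.norm_eq_abs,
    Real.norm_eq_abs, sq_abs, sq_abs]
  simp only [gramMatrix, Matrix.of_apply, real_inner_self_eq_norm_sq]
  ring

variable [IsContMDiffRiemannianBundle (𝓡 2) ∞ Plane (fun x : M => TangentSpace (𝓡 2) x)]

lemma continuousOn_inner_chartVector (p : M) (v w : Plane) :
    ContinuousOn (fun y => inner ℝ (chartVector p y v) (chartVector p y w))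
      (extChartAt (𝓡 2) p).target := by
  have key : ∀ v : Plane,
      ContinuousOn (fun y => (⟨chartPoint p y, chartVector p y v⟩ : TangentBundle (𝓡 2) M))
        (extChartAt (𝓡 2) p).target := by
    intro v
    have h1 := (contMDiffOn_chartPoint p).continuousOn_tangentMapWithin (by simp)
      (isOpen_extChartAt_target (I := 𝓡 2) p).uniqueMDiffOn
    have h2 : Continuous (fun y : Plane => (⟨y, v⟩ : TangentBundle 𝓘(ℝ, Plane) Plane)) :=
      (tangentBundleModelSpaceHomeomorph 𝓘(ℝ, Plane)).symm.continuous.comp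
        (continuous_id.prodMk continuous_const)
    have h3 := h1.comp (h2.continuousOn (s := (extChartAt (𝓡 2) p).target)) (fun y hy => hy)
    refine h3.congr fun y hy => ?_
    simp only [Function.comp, tangentMapWithin]
    rw [mfderivWithin_of_isOpen (isOpen_extChartAt_target (I := 𝓡 2) p) hy]
    rfl
  have : IsContinuousRiemannianBundle Plane (fun x : M => TangentSpace (𝓡 2) x) := by
    obtain ⟨g, hg, hg'⟩ := IsContMDiffRiemannianBundle.exists_contMDiff (IB := 𝓡 2) (n := ∞)
      (F := Plane) (E := fun x : M => TangentSpace (𝓡 2) x)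
    exact ⟨g, hg.continuous, hg'⟩
  exact ContinuousOn.inner_bundle (F := Plane) (key v) (key w)

lemma continuousOn_gramMatrix (p : M) (i j : Fin 2) :
    ContinuousOn (fun y => gramMatrix p y i j) (extChartAt (𝓡 2) p).target :=
  continuousOn_inner_chartVector p _ _

lemma continuousOn_sqrt_det_gramMatrix (p : M) :
    ContinuousOn (fun y => Real.sqrt (gramMatrix p y).det) (extChartAt (𝓡 2) p).target := by
  refine Real.continuous_sqrt.comp_continuousOn ?_
  simp only [Matrix.det_fin_two]
  exact ((continuousOn_gramMatrix p 0 0).mul (continuousOn_gramMatrix p 1 1)).sub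
    ((continuousOn_gramMatrix p 0 1).mul (continuousOn_gramMatrix p 1 0))

/-- Near a point the metric is arbitrarily close, in ratio, to the constant one given by its value
at that point, and so is the area density. -/
lemma eventually_frame_bounds {p : M} {y₀ : Plane} (hy₀ : y₀ ∈ (extChartAt (𝓡 2) p).target)
    {A : Plane ≃L[ℝ] Plane}
    (hA : ∀ v w : Plane,
      inner ℝ (A v) (A w) = inner ℝ (chartVector p y₀ v) (chartVector p y₀ w))
    {κ : ℝ} (hκ : 1 < κ) :
    ∀ᶠ y in 𝓝 y₀, y ∈ (extChartAt (𝓡 2) p).target ∧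
      (∀ v, ‖chartVector p y v‖ ≤ κ * ‖A v‖) ∧ (∀ v, ‖A v‖ ≤ κ * ‖chartVector p y v‖) ∧
      Real.sqrt (gramMatrix p y).det ≤ κ * |(A : Plane →L[ℝ] Plane).det| ∧
      |(A : Plane →L[ℝ] Plane).det| ≤ κ * Real.sqrt (gramMatrix p y).det := by
  have hκ0 : 0 < κ := by linarith
  have hnhds := (isOpen_extChartAt_target (I := 𝓡 2) p).mem_nhds hy₀
  have hdet : 0 < |(A : Plane →L[ℝ] Plane).det| :=
    abs_pos.2 A.toLinearEquiv.isUnit_det'.ne_zero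
  have hcont := (continuousOn_sqrt_det_gramMatrix p).continuousAt hnhds
  rw [ContinuousAt, sqrt_det_gramMatrix_eq (A := (A : Plane →L[ℝ] Plane)) hA] at hcont
  have e1 := hcont.eventually_lt_const
    (show |(A : Plane →L[ℝ] Plane).det| < κ * |(A : Plane →L[ℝ] Plane).det| by nlinarith)
  have e2 := (hcont.const_mul κ).eventually_const_lt
    (show |(A : Plane →L[ℝ] Plane).det| < κ * |(A : Plane →L[ℝ] Plane).det| by nlinarith)
  set c : ℝ := ‖(A.symm : Plane →L[ℝ] Plane)‖ + 1 with hc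
  have hc0 : 0 < c := by positivity
  obtain ⟨η, hη0, hη1, hη2⟩ : ∃ η : ℝ, 0 < η ∧ 1 + 2 * η * c ^ 2 ≤ κ ^ 2 ∧
      1 ≤ κ ^ 2 * (1 - 2 * η * c ^ 2) := by
    have hk : 0 < κ ^ 2 - 1 := by nlinarith
    refine ⟨(κ ^ 2 - 1) / (2 * c ^ 2 * κ ^ 2), by positivity, ?_, le_of_eq ?_⟩
    · have : 2 * ((κ ^ 2 - 1) / (2 * c ^ 2 * κ ^ 2)) * c ^ 2 = (κ ^ 2 - 1) / κ ^ 2 := by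
        field_simp
      rw [this]
      have : (κ ^ 2 - 1) / κ ^ 2 ≤ κ ^ 2 - 1 := div_le_self hk.le (by nlinarith)
      linarith
    · field_simp
      ring
  have hg : ∀ i j : Fin 2, ∀ᶠ y in 𝓝 y₀, |gramMatrix p y i j - gramMatrix p y₀ i j| < η := by
    intro i j
    have := ((continuousOn_gramMatrix p i j).continuousAt hnhds)
    simpa [Real.dist_eq] using Metric.tendsto_nhds.1 this η hη0
  filter_upwards [hnhds, e1, e2, hg 0 0, hg 0 1, hg 1 1] with y hy h1 h2 g00 g01 g11
  have hmain : ∀ v, |‖chartVector p y v‖ ^ 2 - ‖A v‖ ^ 2| ≤ 2 * η * c ^ 2 * ‖A v‖ ^ 2 := by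
    intro v
    have hAv : ‖A v‖ ^ 2 = ‖chartVector p y₀ v‖ ^ 2 := by
      rw [← real_inner_self_eq_norm_sq, hA, real_inner_self_eq_norm_sq]
    have hv : ‖v‖ ≤ c * ‖A v‖ := by
      have := (A.symm : Plane →L[ℝ] Plane).le_opNorm (A v)
      simp only [ContinuousLinearEquiv.coe_coe, ContinuousLinearEquiv.symm_apply_apply] at this
      nlinarith [norm_nonneg (A v)]
    have hv2 : ‖v‖ ^ 2 ≤ c ^ 2 * ‖A v‖ ^ 2 := by
      rw [← mul_pow]; gcongr
    have hvn : ‖v‖ ^ 2 = v 0 ^ 2 + v 1 ^ 2 := by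
      simp [EuclideanSpace.norm_sq_eq]
    have : |‖chartVector p y v‖ ^ 2 - ‖A v‖ ^ 2| ≤ 2 * η * ‖v‖ ^ 2 := by
      rw [hAv, norm_chartVector_sq, norm_chartVector_sq, hvn]
      have hd : ∀ a b : ℝ, |a| < η → |b * a| ≤ |b| * η := fun a b h => by
        rw [abs_mul]; gcongr
      have t0 := hd _ (v 0 ^ 2) g00
      have t1 := hd _ (2 * (v 0 * v 1)) g01
      have t2 := hd _ (v 1 ^ 2) g11
      rw [abs_of_nonneg (sq_nonneg (v 0))] at t0
      rw [abs_of_nonneg (sq_nonneg (v 1))] at t2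
      have t3 : |2 * (v 0 * v 1)| ≤ v 0 ^ 2 + v 1 ^ 2 :=
        abs_le.2 ⟨by nlinarith [sq_nonneg (v 0 + v 1)], by nlinarith [sq_nonneg (v 0 - v 1)]⟩
      have t4 := mul_le_mul_of_nonneg_right t3 hη0.le
      rw [abs_le] at *
      constructor <;> linarith
    nlinarith
  refine ⟨hy, fun v => ?_, fun v => ?_, h1.le, h2.le⟩
  · refine (sq_le_sq₀ (by positivity) (by positivity)).1 ?_
    have := (abs_le.1 (hmain v)).2
    rw [mul_pow]
    nlinarith [sq_nonneg ‖A v‖]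
  · refine (sq_le_sq₀ (by positivity) (by positivity)).1 ?_
    have := (abs_le.1 (hmain v)).1
    rw [mul_pow]
    nlinarith [sq_nonneg ‖A v‖, sq_nonneg κ]

end Geometry

/-! ### Distances in charts -/

section Distance

variable {M : Type*} [MetricSpace M] [ChartedSpace Plane M] [IsManifold (𝓡 2) ∞ M]
  [RiemannianBundle (fun x : M => TangentSpace (𝓡 2) x)]
  [IsRiemannianManifold (𝓡 2) M]

/-- The image in `M` of a segment on which the metric is bounded by that of `A` has length at most
`κ` times that of the segment. -/
lemma dist_chartPoint_le_of_segment {p : M} {s : Set Plane} (hs : Convex ℝ s)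
    (hst : s ⊆ (extChartAt (𝓡 2) p).target) {A : Plane →L[ℝ] Plane} {κ : ℝ} (hκ : 0 ≤ κ)
    (hb : ∀ y ∈ s, ∀ v, ‖chartVector p y v‖ ≤ κ * ‖A v‖) {y y' : Plane} (hy : y ∈ s)
    (hy' : y' ∈ s) :
    dist (chartPoint p y) (chartPoint p y') ≤ κ * ‖A (y - y')‖ := by
  let η : ℝ → Plane := fun t => y + t • (y' - y)
  have hη : ∀ t ∈ Icc (0 : ℝ) 1, η t ∈ s := fun t ht =>
    hs.add_smul_sub_mem hy hy' ht
  have hηs : ContDiff ℝ ∞ η := by fun_prop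
  have hd : ∀ t, HasDerivAt η (y' - y) t := fun t => by
    simpa [η] using ((hasDerivAt_id t).smul_const (y' - y)).const_add y
  have hγ : ContMDiffOn 𝓘(ℝ, ℝ) (𝓡 2) 1 (chartPoint p ∘ η) (Icc 0 1) :=
    ((contMDiffOn_chartPoint p).of_le (by simp)).comp
      ((hηs.of_le (by simp)).contMDiff.contMDiffOn) fun t ht => hst (hη t ht)
  have h1 : edist (chartPoint p y) (chartPoint p y') ≤
      Manifold.pathELength (𝓡 2) (chartPoint p ∘ η) 0 1 := by
    rw [IsRiemannianManifold.out (I := 𝓡 2)]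
    exact Manifold.riemannianEDist_le_pathELength hγ (by simp [η]) (by simp [η]) zero_le_one
  have h2 : Manifold.pathELength (𝓡 2) (chartPoint p ∘ η) 0 1 ≤
      ENNReal.ofReal (κ * ‖A (y - y')‖) := by
    rw [Manifold.pathELength_eq_lintegral_mfderiv_Icc]
    calc ∫⁻ t in Icc (0 : ℝ) 1, ‖mfderiv 𝓘(ℝ, ℝ) (𝓡 2) (chartPoint p ∘ η) t 1‖ₑ
        ≤ ∫⁻ t in Icc (0 : ℝ) 1, ENNReal.ofReal (κ * ‖A (y - y')‖) := by
          refine setLIntegral_mono' measurableSet_Icc fun t ht => ?_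
          have hm := (mdifferentiableAt_chartPoint (hst (hη t ht))).hasMFDerivAt.comp t
            (hd t).hasFDerivAt.hasMFDerivAt
          have h3 : mfderiv 𝓘(ℝ, ℝ) (𝓡 2) (chartPoint p ∘ η) t 1 =
              chartVector p (η t) (y' - y) := by
            have h4 : mfderiv 𝓘(ℝ, ℝ) (𝓡 2) (chartPoint p ∘ η) t 1 =
                chartVector p (η t) ((1 : ℝ) • (y' - y)) := congr($(hm.mfderiv) 1)
            rwa [one_smul] at h4
          rw [h3, ← ofReal_norm]
          refine ENNReal.ofReal_le_ofReal ?_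
          have := hb _ (hη t ht) (y' - y)
          rwa [← neg_sub y y', map_neg, norm_neg, neg_sub] at this
      _ = _ := by simp
  have h3 := h1.trans h2
  rwa [edist_dist, ENNReal.ofReal_le_ofReal_iff (by positivity)] at h3

/-- A path does not leave the ball about its origin whose radius is its length. -/
lemma dist_le_pathELength {γ : ℝ → M} (hγ : ContMDiffOn 𝓘(ℝ, ℝ) (𝓡 2) 1 γ (Icc 0 1)) {t : ℝ}
    (ht : t ∈ Icc (0 : ℝ) 1) :
    edist (γ 0) (γ t) ≤ Manifold.pathELength (𝓡 2) γ 0 1 := by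
  rw [IsRiemannianManifold.out (I := 𝓡 2)]
  exact (Manifold.riemannianEDist_le_pathELength (hγ.mono (Icc_subset_Icc_right ht.2)) rfl rfl
    ht.1).trans (Manifold.pathELength_mono le_rfl ht.2)

/-- A path which stays in a region where the metric dominates that of `A` is not much shorter than
the `A`-distance of its endpoints. -/
lemma enorm_sub_le_pathELength {p : M} {s : Set Plane}
    (hst : s ⊆ (extChartAt (𝓡 2) p).target) {A : Plane →L[ℝ] Plane} {κ : ℝ≥0}
    (hb : ∀ y ∈ s, ∀ v, ‖A v‖ ≤ κ * ‖chartVector p y v‖)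
    {γ : ℝ → M} (hγ : ContMDiffOn 𝓘(ℝ, ℝ) (𝓡 2) 1 γ (Icc 0 1))
    (hγs : ∀ t ∈ Icc (0 : ℝ) 1, γ t ∈ chartPoint p '' s) :
    ‖A (extChartAt (𝓡 2) p (γ 1) - extChartAt (𝓡 2) p (γ 0))‖ₑ ≤
      κ * Manifold.pathELength (𝓡 2) γ 0 1 := by
  have hsrc : ∀ t ∈ Icc (0 : ℝ) 1, γ t ∈ (extChartAt (𝓡 2) p).source := fun t ht => by
    obtain ⟨y, hy, h⟩ := hγs t ht
    rw [← h]; exact chartPoint_mem_source (hst hy)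
  have hc : ContDiffOn ℝ 1 (extChartAt (𝓡 2) p ∘ γ) (Icc 0 1) := by
    rw [← contMDiffOn_iff_contDiffOn]
    exact (contMDiffOn_extChartAt (n := 1)).comp hγ fun t ht => by simpa using hsrc t ht
  have hc' : ContDiffOn ℝ 1 (fun t => A (extChartAt (𝓡 2) p (γ t))) (Icc 0 1) :=
    A.contDiff.comp_contDiffOn hc
  have h1 := enorm_sub_le_lintegral_derivWithin_Icc_of_contDiffOn_Icc hc' zero_le_one
  rw [map_sub]
  refine h1.trans ?_
  rw [Manifold.pathELength_eq_lintegral_mfderivWithin_Icc,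
    ← lintegral_const_mul' _ _ ENNReal.coe_ne_top]
  refine setLIntegral_mono' measurableSet_Icc fun t ht => ?_
  have hu : UniqueMDiffWithinAt 𝓘(ℝ, ℝ) (Icc (0 : ℝ) 1) t := by
    rw [uniqueMDiffWithinAt_iff_uniqueDiffWithinAt]
    exact uniqueDiffOn_Icc zero_lt_one t ht
  have hγd := ((hγ t ht).mdifferentiableWithinAt one_ne_zero).hasMFDerivWithinAt
  have hm := (mdifferentiableAt_extChartAt_of_mem (hsrc t ht)).hasMFDerivAt.comp_hasMFDerivWithinAt
    t hγd
  have hA := (A.hasFDerivAt (x := extChartAt (𝓡 2) p (γ t))).hasMFDerivAt.comp_hasMFDerivWithinAt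
    t hm
  have hd : derivWithin (fun t => A (extChartAt (𝓡 2) p (γ t))) (Icc 0 1) t =
      A (mfderiv (𝓡 2) 𝓘(ℝ, Plane) (extChartAt (𝓡 2) p) (γ t)
        (mfderivWithin 𝓘(ℝ, ℝ) (𝓡 2) γ (Icc 0 1) t 1)) := by
    rw [← fderivWithin_derivWithin, ← mfderivWithin_eq_fderivWithin]
    exact congr($(hA.mfderivWithin hu) 1)
  rw [hd]
  generalize mfderivWithin 𝓘(ℝ, ℝ) (𝓡 2) γ (Icc 0 1) t 1 = w
  obtain ⟨y, hy, hyt⟩ := hγs t ht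
  have key : ∀ w : TangentSpace (𝓡 2) (γ t),
      ‖A (mfderiv (𝓡 2) 𝓘(ℝ, Plane) (extChartAt (𝓡 2) p) (γ t) w)‖ ≤ κ * ‖w‖ := by
    rw [← hyt]
    intro w
    have := hb y hy (mfderiv (𝓡 2) 𝓘(ℝ, Plane) (extChartAt (𝓡 2) p) (chartPoint p y) w)
    rwa [chartVector_mfderiv (hst hy)] at this
  have k2 := key w
  rw [← ofReal_norm, ← ofReal_norm, ← ENNReal.ofReal_coe_nnreal,
    ← ENNReal.ofReal_mul κ.coe_nonneg]
  exact ENNReal.ofReal_le_ofReal k2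

/-- If a metric ball of radius `3ρ` lies in a region where the metric dominates that of `A`, then the
distance of points in the ball of radius `ρ` dominates their `A`-distance: short paths between
such points stay in the region. -/
lemma norm_sub_le_dist_of_ball {p : M} {s : Set Plane}
    (hst : s ⊆ (extChartAt (𝓡 2) p).target) {A : Plane →L[ℝ] Plane} {κ : ℝ≥0} (hκ : 0 < κ)
    (hb : ∀ y ∈ s, ∀ v, ‖A v‖ ≤ κ * ‖chartVector p y v‖) {x₀ : M} {ρ : ℝ}
    (hρs : Metric.ball x₀ (3 * ρ) ⊆ chartPoint p '' s) {x x' : M}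
    (hx : x ∈ Metric.ball x₀ ρ) (hx' : x' ∈ Metric.ball x₀ ρ) :
    ‖A (extChartAt (𝓡 2) p x - extChartAt (𝓡 2) p x')‖ ≤ κ * dist x x' := by
  have hκ0 : (0 : ℝ) < κ := by exact_mod_cast hκ
  rw [Metric.mem_ball] at hx hx'
  have hd : dist x x' < 2 * ρ := by
    have := dist_triangle_right x x' x₀
    linarith
  refine le_of_forall_gt_imp_ge_of_dense fun b hb' => ?_
  obtain ⟨ℓ, hℓ1, hℓ2⟩ : ∃ ℓ, dist x x' < ℓ ∧ ℓ < min (2 * ρ) (b / κ) :=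
    exists_between (lt_min hd (by rwa [lt_div_iff₀ hκ0, mul_comm]))
  have hℓ0 : 0 < ℓ := dist_nonneg.trans_lt hℓ1
  have he : Manifold.riemannianEDist (𝓡 2) x x' < ENNReal.ofReal ℓ := by
    rw [← IsRiemannianManifold.out (I := 𝓡 2), edist_dist]
    exact (ENNReal.ofReal_lt_ofReal_iff hℓ0).2 hℓ1
  obtain ⟨γ, hγ0, hγ1, hγ, hγl⟩ := Manifold.exists_lt_of_riemannianEDist_lt he
  have hγs : ∀ t ∈ Icc (0 : ℝ) 1, γ t ∈ chartPoint p '' s := fun t ht => by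
    refine hρs ?_
    have h4 := (dist_le_pathELength hγ ht).trans_lt hγl
    rw [edist_dist, ENNReal.ofReal_lt_ofReal_iff hℓ0, hγ0] at h4
    have h5 := dist_triangle_left (γ t) x₀ x
    have := hℓ2.trans_le (min_le_left _ _)
    rw [Metric.mem_ball]
    linarith
  have h6 := enorm_sub_le_pathELength hst hb hγ hγs
  rw [hγ0, hγ1] at h6
  have h7 : ‖A (extChartAt (𝓡 2) p x - extChartAt (𝓡 2) p x')‖ₑ ≤ ENNReal.ofReal (κ * ℓ) := by
    rw [← neg_sub, map_neg, enorm_neg]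
    refine h6.trans ?_
    rw [ENNReal.ofReal_mul hκ0.le, ENNReal.ofReal_coe_nnreal]
    exact mul_le_mul_right hγl.le _
  rw [← ofReal_norm, ENNReal.ofReal_le_ofReal_iff (by positivity)] at h7
  refine h7.trans ?_
  have := hℓ2.trans_le (min_le_right _ _)
  rw [lt_div_iff₀ hκ0] at this
  linarith

variable [IsContMDiffRiemannianBundle (𝓡 2) ∞ Plane (fun x : M => TangentSpace (𝓡 2) x)]

/-- Charts are almost isometric, after a linear change of coordinates: near a point, distances and
area densities agree with the Euclidean ones up to a factor arbitrarily close to `1`. -/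
theorem exists_ball_almost_isometry {p : M} {y₀ : Plane}
    (hy₀ : y₀ ∈ (extChartAt (𝓡 2) p).target) {A : Plane ≃L[ℝ] Plane}
    (hA : ∀ v w : Plane,
      inner ℝ (A v) (A w) = inner ℝ (chartVector p y₀ v) (chartVector p y₀ w))
    {κ : ℝ} (hκ : 1 < κ) :
    ∃ r > 0, Metric.ball y₀ r ⊆ (extChartAt (𝓡 2) p).target ∧
      ∀ y ∈ Metric.ball y₀ r,
        (∀ v, ‖chartVector p y v‖ ≤ κ * ‖A v‖) ∧
        Real.sqrt (gramMatrix p y).det ≤ κ * |(A : Plane →L[ℝ] Plane).det| ∧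
        |(A : Plane →L[ℝ] Plane).det| ≤ κ * Real.sqrt (gramMatrix p y).det ∧
        ∀ y' ∈ Metric.ball y₀ r,
          dist (chartPoint p y) (chartPoint p y') ≤ κ * ‖A (y - y')‖ ∧
          ‖A (y - y')‖ ≤ κ * dist (chartPoint p y) (chartPoint p y') := by
  have hκ0 : 0 < κ := by linarith
  lift κ to ℝ≥0 using hκ0.le
  obtain ⟨r₁, hr₁, h₁⟩ := Metric.eventually_nhds_iff_ball.1 (eventually_frame_bounds hy₀ hA hκ)
  have hst : Metric.ball y₀ r₁ ⊆ (extChartAt (𝓡 2) p).target := fun y hy => (h₁ y hy).1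
  have hx₀ := chartPoint_mem_source hy₀
  -- A metric ball of `M` of radius `3 * ρ` lies in the region where the metric is controlled, so
  -- short paths between points of the ball of radius `ρ` stay in that region.
  obtain ⟨ρ, hρ, hρs⟩ : ∃ ρ > 0, Metric.ball (chartPoint p y₀) (3 * ρ) ⊆
      chartPoint p '' Metric.ball y₀ r₁ := by
    have hc := (continuousAt_extChartAt' (I := 𝓡 2) hx₀).preimage_mem_nhds
      (by rw [extChartAt_chartPoint hy₀]; exact Metric.ball_mem_nhds y₀ hr₁)
    have hc2 := inter_mem hc ((isOpen_extChartAt_source (I := 𝓡 2) p).mem_nhds hx₀)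
    obtain ⟨ε, hε, hε'⟩ := Metric.mem_nhds_iff.1 hc2
    refine ⟨ε / 3, by positivity, fun x hx => ?_⟩
    rw [mul_div_cancel₀ ε three_ne_zero] at hx
    have := hε' hx
    exact ⟨_, this.1, chartPoint_extChartAt this.2⟩
  have hcont := ((continuousOn_chartPoint p).continuousAt
    ((isOpen_extChartAt_target (I := 𝓡 2) p).mem_nhds hy₀)).preimage_mem_nhds
    (Metric.ball_mem_nhds _ hρ)
  obtain ⟨r₂, hr₂, h₂⟩ := Metric.mem_nhds_iff.1 hcont
  refine ⟨min r₁ r₂, lt_min hr₁ hr₂,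
    (Metric.ball_subset_ball (min_le_left _ _)).trans hst, fun y hy => ?_⟩
  have hy1 : y ∈ Metric.ball y₀ r₁ := Metric.ball_subset_ball (min_le_left _ _) hy
  have hy2 : chartPoint p y ∈ Metric.ball (chartPoint p y₀) ρ :=
    h₂ (Metric.ball_subset_ball (min_le_right _ _) hy)
  refine ⟨(h₁ y hy1).2.1, (h₁ y hy1).2.2.2.1, (h₁ y hy1).2.2.2.2, fun y' hy' => ?_⟩
  have hy1' : y' ∈ Metric.ball y₀ r₁ := Metric.ball_subset_ball (min_le_left _ _) hy'
  have hy2' : chartPoint p y' ∈ Metric.ball (chartPoint p y₀) ρ :=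
    h₂ (Metric.ball_subset_ball (min_le_right _ _) hy')
  refine ⟨dist_chartPoint_le_of_segment (A := (A : Plane →L[ℝ] Plane)) (convex_ball y₀ r₁) hst hκ0.le
    (fun z hz => (h₁ z hz).2.1) hy1 hy1', ?_⟩
  have h6 := norm_sub_le_dist_of_ball (κ := κ) (A := (A : Plane →L[ℝ] Plane)) hst
    (by exact_mod_cast hκ0) (fun z hz => (h₁ z hz).2.2.1) hρs hy2 hy2'
  rwa [extChartAt_chartPoint (hst hy1), extChartAt_chartPoint (hst hy1')] at h6

end Distance

/-! ### The area of small discs -/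

section Area

variable {M : Type*} [MetricSpace M] [ChartedSpace Plane M]
  [RiemannianBundle (fun x : M => TangentSpace (𝓡 2) x)]
  [MeasurableSpace M] [BorelSpace M]

lemma measurableSet_target (p : M) : MeasurableSet (extChartAt (𝓡 2) p).target :=
  (isOpen_extChartAt_target p).measurableSet

lemma measurableSet_source (p : M) : MeasurableSet (extChartAt (𝓡 2) p).source :=
  (isOpen_extChartAt_source p).measurableSet

variable [IsManifold (𝓡 2) ∞ M]

lemma chartArea_apply (p : M) {S : Set M} (hS : MeasurableSet S) :
    chartArea p S = ∫⁻ y in chartPoint p ⁻¹' S ∩ (extChartAt (𝓡 2) p).target,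
      ENNReal.ofReal (Real.sqrt (gramMatrix p y).det) := by
  have h : AEMeasurable (chartPoint p) (volume.restrict (extChartAt (𝓡 2) p).target) :=
    (continuousOn_chartPoint p).aemeasurable (measurableSet_target p)
  rw [chartArea, Measure.map_apply_of_aemeasurable
    (h.mono_ac (withDensity_absolutelyContinuous _ _)) hS, withDensity_apply',
    Measure.restrict_restrict' (measurableSet_target p)]

lemma chartArea_source_compl (p : M) : chartArea p (extChartAt (𝓡 2) p).sourceᶜ = 0 := by
  rw [chartArea_apply p (measurableSet_source p).compl]
  have : chartPoint p ⁻¹' (extChartAt (𝓡 2) p).sourceᶜ ∩ (extChartAt (𝓡 2) p).target = ∅ := by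
    ext y
    simp only [mem_inter_iff, mem_preimage, mem_compl_iff, mem_empty_iff_false, iff_false, not_and]
    exact fun h hy => h (chartPoint_mem_source hy)
  rw [this]; simp

/-- The transition map from the chart centred at `q` to that centred at `p` intertwines the
coordinate vectors of the two charts. -/
lemma chartVector_transition {p q : M} {y : Plane} (hy : y ∈ (extChartAt (𝓡 2) q).target)
    (hyp : chartPoint q y ∈ (extChartAt (𝓡 2) p).source) :
    ∃ T : Plane →L[ℝ] Plane,
      HasFDerivAt (fun y => extChartAt (𝓡 2) p (chartPoint q y)) T y ∧
      ∀ v w, inner ℝ (chartVector p (extChartAt (𝓡 2) p (chartPoint q y)) (T v))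
          (chartVector p (extChartAt (𝓡 2) p (chartPoint q y)) (T w)) =
        inner ℝ (chartVector q y v) (chartVector q y w) := by
  have hm := (mdifferentiableAt_extChartAt_of_mem hyp).hasMFDerivAt.comp y
    (mdifferentiableAt_chartPoint hy).hasMFDerivAt
  refine ⟨_, hm.hasFDerivAt, fun v w => ?_⟩
  have key : ∀ x ∈ (extChartAt (𝓡 2) p).source, ∀ v w : TangentSpace (𝓡 2) x,
      inner ℝ (chartVector p (extChartAt (𝓡 2) p x)
        (mfderiv (𝓡 2) 𝓘(ℝ, Plane) (extChartAt (𝓡 2) p) x v))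
        (chartVector p (extChartAt (𝓡 2) p x)
        (mfderiv (𝓡 2) 𝓘(ℝ, Plane) (extChartAt (𝓡 2) p) x w)) = inner ℝ v w := by
    intro x hx
    obtain ⟨z, hz, rfl⟩ : ∃ z ∈ (extChartAt (𝓡 2) p).target, chartPoint p z = x :=
      ⟨_, (extChartAt (𝓡 2) p).map_source hx, chartPoint_extChartAt hx⟩
    intro v w
    rw [extChartAt_chartPoint hz]
    exact congrArg₂ (inner ℝ) (chartVector_mfderiv hz v) (chartVector_mfderiv hz w)
  exact key _ hyp (chartVector q y v) (chartVector q y w)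

/-- The local area measures of two charts agree on the overlap, by the change of variables
formula. -/
lemma chartArea_le_chartArea (p q : M) {S : Set M} (hS : MeasurableSet S)
    (hSp : S ⊆ (extChartAt (𝓡 2) p).source) : chartArea q S ≤ chartArea p S := by
  rw [chartArea_apply q hS, chartArea_apply p hS]
  set U := chartPoint q ⁻¹' S ∩ (extChartAt (𝓡 2) q).target with hU
  have hUm : MeasurableSet U := by
    obtain ⟨c⟩ : Nonempty M := ⟨q⟩
    classical
    have h := (continuousOn_chartPoint q).measurable_piecewise
      (continuousOn_const (c := c) (s := (extChartAt (𝓡 2) q).targetᶜ)) (measurableSet_target q)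
    have : U = ((extChartAt (𝓡 2) q).target.piecewise (chartPoint q) fun _ => c) ⁻¹' S ∩
        (extChartAt (𝓡 2) q).target := by
      ext y
      simp only [hU, mem_inter_iff, mem_preimage]
      refine and_congr_left fun hy => ?_
      rw [piecewise_eq_of_mem _ _ _ hy]
    rw [this]
    exact (h hS).inter (measurableSet_target q)
  choose! T hT hT' using fun y (hy : y ∈ U) => chartVector_transition hy.2 (hSp hy.1)
  set τ : Plane → Plane := fun y => extChartAt (𝓡 2) p (chartPoint q y) with hτ
  have hinj : InjOn τ U := by
    intro y hy z hz h
    have h1 := (extChartAt (𝓡 2) p).injOn (hSp hy.1) (hSp hz.1) h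
    rw [← extChartAt_chartPoint hy.2, ← extChartAt_chartPoint hz.2, h1]
  have himg : τ '' U ⊆ chartPoint p ⁻¹' S ∩ (extChartAt (𝓡 2) p).target := by
    rintro _ ⟨y, hy, rfl⟩
    refine ⟨?_, (extChartAt (𝓡 2) p).map_source (hSp hy.1)⟩
    rw [mem_preimage, hτ, chartPoint_extChartAt (hSp hy.1)]
    exact hy.1
  calc ∫⁻ y in U, ENNReal.ofReal (Real.sqrt (gramMatrix q y).det)
      = ∫⁻ y in U, ENNReal.ofReal |(T y).det| *
          ENNReal.ofReal (Real.sqrt (gramMatrix p (τ y)).det) := by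
        refine setLIntegral_congr_fun hUm fun y hy => ?_
        have hz := (himg ⟨y, hy, rfl⟩).2
        obtain ⟨A, hA⟩ := exists_linear_isometry_frame hz
        have h1 := sqrt_det_gramMatrix_eq (A := (A : Plane →L[ℝ] Plane)) hA
        have h2 := sqrt_det_gramMatrix_eq (p := q) (y := y) (A := (A : Plane →L[ℝ] Plane) ∘L T y)
          (fun v w => by
            rw [← hT' y hy v w]
            exact hA _ _)
        rw [h1, h2, ← ENNReal.ofReal_mul (abs_nonneg _), ← abs_mul, mul_comm (T y).det]
        congr 2
        exact LinearMap.det_comp _ _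
    _ = ∫⁻ z in τ '' U, ENNReal.ofReal (Real.sqrt (gramMatrix p z).det) :=
        (lintegral_image_eq_lintegral_abs_det_fderiv_mul volume hUm
          (fun y hy => (hT y hy).hasFDerivWithinAt) hinj
          fun z => ENNReal.ofReal (Real.sqrt (gramMatrix p z).det)).symm
    _ ≤ _ := lintegral_mono_set himg

lemma chartArea_le_area (p : M) : chartArea p ≤ area M := le_iSup (fun p => chartArea p) p

/-- On the domain of a chart the area, defined as a supremum over all charts, is bounded by the
area in that chart. -/
lemma area_restrict_source_le (p : M) :
    (area M).restrict (extChartAt (𝓡 2) p).source ≤ chartArea p := by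
  -- A supremum of measures is the least measure above all of them, so the bound outside the
  -- domain of the chart is made trivial by a measure which is infinite on nonempty sets there.
  have h1 : area M ≤ chartArea p +
      ((⊤ : ℝ≥0∞) • Measure.count).restrict (extChartAt (𝓡 2) p).sourceᶜ := by
    refine iSup_le fun q => Measure.le_iff.2 fun S hS => ?_
    rw [Measure.add_apply, Measure.restrict_apply hS]
    by_cases h : S ⊆ (extChartAt (𝓡 2) p).source
    · exact (chartArea_le_chartArea p q hS h).trans le_self_add
    · have : (S ∩ (extChartAt (𝓡 2) p).sourceᶜ).Nonempty := by
        obtain ⟨x, hx, hx'⟩ := not_subset.1 h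
        exact ⟨x, hx, hx'⟩
      rw [Measure.smul_apply, smul_eq_mul, ENNReal.top_mul (Measure.count_ne_zero this), add_top]
      exact le_top
  refine Measure.le_iff.2 fun S hS => ?_
  rw [Measure.restrict_apply hS]
  refine (h1 _).trans ?_
  rw [Measure.add_apply, Measure.restrict_apply (hS.inter (measurableSet_source p)), inter_assoc,
    inter_compl_self, inter_empty, measure_empty, add_zero]
  exact measure_mono inter_subset_left

lemma area_le_chartArea (p : M) {S : Set M} (hS : MeasurableSet S)
    (hSp : S ⊆ (extChartAt (𝓡 2) p).source) : area M S ≤ chartArea p S := by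
  have := area_restrict_source_le p S
  rwa [Measure.restrict_apply hS, inter_eq_left.2 hSp] at this

/-- A property which holds almost everywhere in a chart holds almost everywhere for the area on
the domain of the chart. -/
lemma ae_area_restrict_source {p : M} {P : M → Prop}
    (h : ∀ᵐ y, y ∈ (extChartAt (𝓡 2) p).target → P (chartPoint p y)) :
    ∀ᵐ x ∂(area M).restrict (extChartAt (𝓡 2) p).source, P x := by
  refine ae_mono (area_restrict_source_le p) ?_
  change ∀ᵐ x ∂chartArea p, P x
  classical
  obtain ⟨N, hN, hNm, hN0⟩ := exists_measurable_superset_of_null (ae_iff.1 h)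
  have hm := (continuousOn_extChartAt (I := 𝓡 2) p).measurable_piecewise
      (continuousOn_const (c := (0 : Plane)) (s := (extChartAt (𝓡 2) p).sourceᶜ))
      (measurableSet_source p)
  set f := (extChartAt (𝓡 2) p).source.piecewise (extChartAt (𝓡 2) p) (fun _ => (0 : Plane))
  have hf : ∀ x ∈ (extChartAt (𝓡 2) p).source, f x = extChartAt (𝓡 2) p x :=
    fun x hx => piecewise_eq_of_mem _ _ _ hx
  rw [ae_iff]
  have hsub : {x | ¬ P x} ⊆ (extChartAt (𝓡 2) p).sourceᶜ ∪ f ⁻¹' N := by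
    intro x hx
    by_cases hxs : x ∈ (extChartAt (𝓡 2) p).source
    · right
      rw [mem_preimage, hf x hxs]
      refine hN fun hP => hx ?_
      have := hP ((extChartAt (𝓡 2) p).map_source hxs)
      rwa [chartPoint_extChartAt hxs] at this
    · exact Or.inl hxs
  refine measure_mono_null hsub (measure_union_null (chartArea_source_compl p) ?_)
  rw [chartArea_apply p (hm hNm)]
  have hsub2 : chartPoint p ⁻¹' (f ⁻¹' N) ∩ (extChartAt (𝓡 2) p).target ⊆ N := by
    rintro y ⟨hy1, hy2⟩
    rw [mem_preimage, mem_preimage, hf _ (chartPoint_mem_source hy2),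
      extChartAt_chartPoint hy2] at hy1
    exact hy1
  exact setLIntegral_measure_zero _ _ (measure_mono_null hsub2 hN0)

lemma aemeasurable_area_restrict_source {p : M} {f : M → ℝ}
    (h : AEMeasurable (fun y => f (chartPoint p y)) (volume.restrict (extChartAt (𝓡 2) p).target)) :
    AEMeasurable f ((area M).restrict (extChartAt (𝓡 2) p).source) := by
  obtain ⟨g, hg, hfg⟩ := h
  rw [EventuallyEq, ae_restrict_iff' (measurableSet_target p)] at hfg
  have hfg' : ∀ᵐ y, y ∈ (extChartAt (𝓡 2) p).target →
      f (chartPoint p y) = g (extChartAt (𝓡 2) p (chartPoint p y)) := by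
    filter_upwards [hfg] with y hy hyt
    rw [hy hyt, extChartAt_chartPoint hyt]
  have h2 : AEMeasurable (fun x => g (extChartAt (𝓡 2) p x))
      ((area M).restrict (extChartAt (𝓡 2) p).source) :=
    hg.comp_aemeasurable ((continuousOn_extChartAt p).aemeasurable (measurableSet_source p))
  exact h2.congr (EventuallyEq.symm (ae_area_restrict_source hfg'))

variable [CompactSpace M]

lemma exists_finset_iUnion_source :
    ∃ t : Finset M, ⋃ p ∈ t, (extChartAt (𝓡 2) p).source = univ := by
  obtain ⟨t, -, ht⟩ := isCompact_univ.elim_nhds_subcover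
    (fun p : M => (extChartAt (𝓡 2) p).source)
    fun p _ => extChartAt_source_mem_nhds p
  exact ⟨t, univ_subset_iff.1 ht⟩

/-- Null sets for the area can be tested in charts. -/
lemma ae_area {P : M → Prop}
    (h : ∀ p : M, ∀ᵐ y, y ∈ (extChartAt (𝓡 2) p).target → P (chartPoint p y)) :
    ∀ᵐ x ∂(area M), P x := by
  obtain ⟨t, ht⟩ := exists_finset_iUnion_source (M := M)
  rw [← Measure.restrict_univ (μ := area M), ← ht, ae_restrict_biUnion_finset_iff]
  exact fun p _ => ae_area_restrict_source (h p)

lemma aemeasurable_area {f : M → ℝ}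
    (h : ∀ p : M, AEMeasurable (fun y => f (chartPoint p y))
      (volume.restrict (extChartAt (𝓡 2) p).target)) :
    AEMeasurable f (area M) := by
  obtain ⟨t, ht⟩ := exists_finset_iUnion_source (M := M)
  have ht' : ⋃ p : t, (extChartAt (𝓡 2) (p : M)).source = univ := by
    rw [← ht]; ext x; simp
  rw [← Measure.restrict_univ (μ := area M), ← ht']
  exact AEMeasurable.iUnion fun p : t => aemeasurable_area_restrict_source (h p)

variable [IsContMDiffRiemannianBundle (𝓡 2) ∞ Plane (fun x : M => TangentSpace (𝓡 2) x)]
  [IsRiemannianManifold (𝓡 2) M]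

/-- Small balls have nearly the area of Euclidean discs, locally uniformly in the centre. -/
lemma eventually_area_ball_bounds (x₀ : M) {κ : ℝ} (hκ : 1 < κ) :
    ∀ᶠ z : ℝ × M in 𝓝 (0, x₀), 0 < z.1 →
      area M (Metric.ball z.2 z.1) ≤ ENNReal.ofReal (κ ^ 3 * Real.pi * z.1 ^ 2) ∧
      ENNReal.ofReal ((κ ^ 3)⁻¹ * Real.pi * z.1 ^ 2) ≤ area M (Metric.ball z.2 z.1) := by
  have hκ0 : 0 < κ := by linarith
  have hx₀ : x₀ ∈ (extChartAt (𝓡 2) x₀).source := mem_extChartAt_source x₀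
  have hy₀ := (extChartAt (𝓡 2) x₀).map_source hx₀
  set y₀ := extChartAt (𝓡 2) x₀ x₀
  obtain ⟨A, hA⟩ := exists_linear_isometry_frame hy₀
  obtain ⟨r, hr, hst, hb⟩ := exists_ball_almost_isometry hy₀ hA hκ
  have hdet : (A : Plane →L[ℝ] Plane).det ≠ 0 := A.toLinearEquiv.isUnit_det'.ne_zero
  have hdet' : 0 < |(A : Plane →L[ℝ] Plane).det| := abs_pos.2 hdet
  have hvol : ∀ (a : Plane) (s : ℝ), 0 ≤ s → volume (A ⁻¹' Metric.ball a s) =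
      ENNReal.ofReal (|(A : Plane →L[ℝ] Plane).det|⁻¹ * Real.pi * s ^ 2) := by
    intro a s hs
    have h := Measure.addHaar_preimage_continuousLinearMap volume (f := (A : Plane →L[ℝ] Plane))
      hdet (Metric.ball a s)
    refine h.trans ?_
    rw [EuclideanSpace.volume_ball_fin_two, abs_inv, ← ENNReal.ofReal_pow hs,
      ← ENNReal.ofReal_mul (by positivity), ← ENNReal.ofReal_mul (by positivity)]
    congr 1
    rw [ContinuousLinearMap.det]
    ring
  obtain ⟨ρ, hρ, hρs⟩ : ∃ ρ > 0, Metric.ball x₀ ρ ⊆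
      (extChartAt (𝓡 2) x₀).source ∩ extChartAt (𝓡 2) x₀ ⁻¹' Metric.ball y₀ (r / 2) :=
    Metric.mem_nhds_iff.1 (inter_mem (extChartAt_source_mem_nhds x₀)
      ((continuousAt_extChartAt x₀).preimage_mem_nhds (Metric.ball_mem_nhds _ (by positivity))))
  set c : ℝ := ‖(A.symm : Plane →L[ℝ] Plane)‖ + 1
  have hc0 : 0 < c := by positivity
  have e1 : ∀ᶠ z : ℝ × M in 𝓝 (0, x₀), z.1 < min (ρ / 2) (r * κ / (2 * c)) :=
    (continuous_fst.tendsto _).eventually_lt_const (by positivity)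
  have e2 : ∀ᶠ z : ℝ × M in 𝓝 (0, x₀), z.2 ∈ Metric.ball x₀ (ρ / 2) :=
    (continuous_snd.tendsto ((0 : ℝ), x₀)).eventually_mem (Metric.ball_mem_nhds _ (by positivity))
  filter_upwards [e1, e2]
  rintro ⟨s, x⟩ h1 h2 hs
  dsimp only at h1 h2 hs ⊢
  have hsρ := h1.trans_le (min_le_left _ _)
  have hsr := h1.trans_le (min_le_right _ _)
  have hsub : Metric.ball x s ⊆ Metric.ball x₀ ρ := fun z hz => by
    rw [Metric.mem_ball] at *
    linarith [dist_triangle z x x₀]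
  have hxm := hρs (hsub (Metric.mem_ball_self hs))
  set y := extChartAt (𝓡 2) x₀ x with hy
  have hyr : y ∈ Metric.ball y₀ r := Metric.ball_subset_ball (by linarith) hxm.2
  have hxy : chartPoint x₀ y = x := chartPoint_extChartAt hxm.1
  constructor
  · refine (area_le_chartArea x₀ Metric.isOpen_ball.measurableSet
      fun z hz => (hρs (hsub hz)).1).trans ?_
    rw [chartArea_apply x₀ Metric.isOpen_ball.measurableSet]
    have hV : chartPoint x₀ ⁻¹' Metric.ball x s ∩ (extChartAt (𝓡 2) x₀).target ⊆
        Metric.ball y₀ r ∩ A ⁻¹' Metric.ball (A y) (κ * s) := by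
      rintro z ⟨hz1, hz2⟩
      have hz3 := (hρs (hsub hz1)).2
      rw [mem_preimage, extChartAt_chartPoint hz2] at hz3
      have hz4 : z ∈ Metric.ball y₀ r := Metric.ball_subset_ball (by linarith) hz3
      refine ⟨hz4, ?_⟩
      have h3 := ((hb z hz4).2.2.2 y hyr).2
      rw [mem_preimage, Metric.mem_ball, dist_eq_norm, ← map_sub]
      refine h3.trans_lt ?_
      rw [mem_preimage, Metric.mem_ball] at hz1
      rw [hxy]
      gcongr
    refine (lintegral_mono_set hV).trans ?_
    calc ∫⁻ z in Metric.ball y₀ r ∩ A ⁻¹' Metric.ball (A y) (κ * s),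
          ENNReal.ofReal (Real.sqrt (gramMatrix x₀ z).det)
        ≤ ∫⁻ z in Metric.ball y₀ r ∩ A ⁻¹' Metric.ball (A y) (κ * s),
          ENNReal.ofReal (κ * |(A : Plane →L[ℝ] Plane).det|) :=
          setLIntegral_mono' (Metric.isOpen_ball.inter
            (Metric.isOpen_ball.preimage A.continuous)).measurableSet
            fun z hz => ENNReal.ofReal_le_ofReal (hb z hz.1).2.1
      _ ≤ ENNReal.ofReal (κ * |(A : Plane →L[ℝ] Plane).det|) *
          volume (A ⁻¹' Metric.ball (A y) (κ * s)) := by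
          rw [setLIntegral_const]
          gcongr
          exact inter_subset_right
      _ = ENNReal.ofReal (κ ^ 3 * Real.pi * s ^ 2) := by
          rw [hvol _ _ (by positivity), ← ENNReal.ofReal_mul (by positivity)]
          congr 1
          field_simp
  · refine le_trans ?_ (chartArea_le_area x₀ _)
    rw [chartArea_apply x₀ Metric.isOpen_ball.measurableSet]
    have hW : A ⁻¹' Metric.ball (A y) (s / κ) ⊆ Metric.ball y₀ r := by
      intro z hz
      rw [mem_preimage, Metric.mem_ball, dist_eq_norm, ← map_sub] at hz
      have h3 := (A.symm : Plane →L[ℝ] Plane).le_opNorm (A (z - y))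
      simp only [ContinuousLinearEquiv.coe_coe, ContinuousLinearEquiv.symm_apply_apply] at h3
      have h4 : ‖z - y‖ ≤ c * (s / κ) :=
        h3.trans (mul_le_mul (by simp [c]) hz.le (norm_nonneg _) hc0.le)
      have h5 : c * (s / κ) < r / 2 := by
        rw [lt_div_iff₀ (by positivity)] at hsr
        rw [mul_div_assoc', div_lt_iff₀ hκ0]
        linarith
      have h6 := hxm.2
      rw [mem_preimage, Metric.mem_ball] at h6
      rw [Metric.mem_ball]
      have := dist_triangle z y y₀
      rw [dist_eq_norm z y] at this
      linarith
    have hV : A ⁻¹' Metric.ball (A y) (s / κ) ⊆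
        chartPoint x₀ ⁻¹' Metric.ball x s ∩ (extChartAt (𝓡 2) x₀).target := by
      intro z hz
      refine ⟨?_, hst (hW hz)⟩
      have h3 := ((hb z (hW hz)).2.2.2 y hyr).1
      rw [mem_preimage, Metric.mem_ball, dist_eq_norm, ← map_sub, lt_div_iff₀ hκ0, mul_comm] at hz
      rw [hxy] at h3
      exact h3.trans_lt hz
    refine le_trans ?_ (lintegral_mono_set hV)
    calc ENNReal.ofReal ((κ ^ 3)⁻¹ * Real.pi * s ^ 2)
        = ENNReal.ofReal (κ⁻¹ * |(A : Plane →L[ℝ] Plane).det|) *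
          volume (A ⁻¹' Metric.ball (A y) (s / κ)) := by
          rw [hvol _ _ (by positivity), ← ENNReal.ofReal_mul (by positivity)]
          congr 1
          field_simp
      _ = ∫⁻ z in A ⁻¹' Metric.ball (A y) (s / κ),
          ENNReal.ofReal (κ⁻¹ * |(A : Plane →L[ℝ] Plane).det|) := by rw [setLIntegral_const]
      _ ≤ _ := setLIntegral_mono' (Metric.isOpen_ball.preimage A.continuous).measurableSet
            fun z hz => ENNReal.ofReal_le_ofReal (by
              rw [inv_mul_le_iff₀ hκ0]
              exact (hb z (hW hz)).2.2.1)

/-- Balls of small radius `s` have area at most `κ³πs²` and at least `κ⁻³πs²`, uniformly in the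
centre, for any `κ > 1`. -/
theorem exists_radius_area_ball_bounds {κ : ℝ} (hκ : 1 < κ) :
    ∃ r > 0, ∀ s, 0 < s → s < r → ∀ x : M,
      area M (Metric.ball x s) ≤ ENNReal.ofReal (κ ^ 3 * Real.pi * s ^ 2) ∧
      ENNReal.ofReal ((κ ^ 3)⁻¹ * Real.pi * s ^ 2) ≤ area M (Metric.ball x s) := by
  have h := isCompact_univ.eventually_forall_of_forall_eventually (x₀ := (0 : ℝ)) (K := univ)
    (P := fun s (x : M) => 0 < s →
      area M (Metric.ball x s) ≤ ENNReal.ofReal (κ ^ 3 * Real.pi * s ^ 2) ∧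
      ENNReal.ofReal ((κ ^ 3)⁻¹ * Real.pi * s ^ 2) ≤ area M (Metric.ball x s))
    fun x _ => eventually_area_ball_bounds x hκ
  obtain ⟨r, hr, h⟩ := Metric.eventually_nhds_iff_ball.1 h
  refine ⟨r, hr, fun s hs hsr x => h s ?_ x (mem_univ x) hs⟩
  simpa [abs_of_pos hs] using hsr

end Area

/-! ### Weak gradients of Lipschitz functions -/

section Euclidean

/-- Rademacher's theorem for locally Lipschitz functions on an open set. -/
lemma ae_differentiableAt_of_locallyLipschitzOn {f : Plane → ℝ} {s : Set Plane} (hs : IsOpen s)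
    (hf : LocallyLipschitzOn s f) : ∀ᵐ y, y ∈ s → DifferentiableAt ℝ f y := by
  rw [ae_iff]
  refine measure_null_of_locally_null _ fun y hy => ?_
  simp only [Classical.not_imp, mem_ofPred_eq] at hy
  obtain ⟨K, t, ht, hK⟩ := hf hy.1
  rw [hs.nhdsWithin_eq hy.1] at ht
  obtain ⟨t', ht', hto, hyt'⟩ := mem_nhds_iff.1 ht
  refine ⟨{z | ¬ (z ∈ s → DifferentiableAt ℝ f z)} ∩ t',
    inter_mem_nhdsWithin _ (hto.mem_nhds hyt'), ?_⟩
  refine measure_mono_null ?_ (ae_iff.1 ((hK.mono ht').ae_differentiableWithinAt_of_mem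
    (μ := volume)))
  rintro z ⟨hz, hzt⟩ h
  exact hz fun _ => (h hzt).differentiableAt (hto.mem_nhds hzt)

/-- Integration by parts for a locally Lipschitz function on an open set against a test function
with compact support in it. The function is replaced by a globally Lipschitz one which agrees with
it on the support of the test function. -/
lemma setIntegral_mul_fderiv_eq_neg {f : Plane → ℝ} {s : Set Plane} (hs : IsOpen s)
    (hf : LocallyLipschitzOn s f) {ψ : Plane → ℝ} (hψ : ContDiff ℝ ∞ ψ)
    (hψc : HasCompactSupport ψ) (hψs : tsupport ψ ⊆ s) (v : Plane) :
    ∫ y in s, f y * fderiv ℝ ψ y v = -∫ y in s, fderiv ℝ f y v * ψ y := by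
  obtain ⟨C, hC⟩ := LocallyLipschitzOn.exists_lipschitzOnWith_of_compact
    (s := tsupport ψ) hψc (hf.mono hψs)
  obtain ⟨g, hg, hfg⟩ := hC.extend_real
  obtain ⟨D, hD⟩ := hψ.lipschitzWith_of_hasCompactSupport hψc (by simp)
  have key := hg.integral_lineDeriv_mul_eq (μ := volume) hD hψc v
  have hψd : Differentiable ℝ ψ := hψ.differentiable (by simp)
  have h1 : ∫ y in s, f y * fderiv ℝ ψ y v = -∫ y, lineDeriv ℝ ψ y (-v) * g y := by
    rw [setIntegral_eq_integral_of_forall_compl_eq_zero, ← integral_neg]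
    · refine integral_congr_ae (ae_of_all _ fun y => ?_)
      dsimp only
      rw [(hψd y).lineDeriv_eq_fderiv, map_neg]
      by_cases hy : y ∈ tsupport ψ
      · rw [hfg hy]; ring
      · have : fderiv ℝ ψ y = 0 :=
          image_eq_zero_of_notMem_tsupport fun h => hy (tsupport_fderiv_subset ℝ h)
        simp [this]
    · intro y hy
      have : fderiv ℝ ψ y = 0 :=
        image_eq_zero_of_notMem_tsupport fun h => hy (hψs (tsupport_fderiv_subset ℝ h))
      simp [this]
  have h2 : ∫ y in s, fderiv ℝ f y v * ψ y = ∫ y, lineDeriv ℝ g y v * ψ y := by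
    rw [setIntegral_eq_integral_of_forall_compl_eq_zero]
    · refine integral_congr_ae ?_
      filter_upwards [ae_differentiableAt_of_locallyLipschitzOn hs hf] with y hy
      by_cases h0 : ψ y = 0
      · simp [h0]
      · have hys : y ∈ Function.support ψ := h0
        have hyt := subset_tsupport ψ hys
        have hE : g =ᶠ[𝓝 y] f := by
          filter_upwards [hψ.continuous.isOpen_support.mem_nhds hys] with z hz
          exact (hfg (subset_tsupport ψ hz)).symm
        have hd := hy (hψs hyt)
        rw [(hd.congr_of_eventuallyEq hE).lineDeriv_eq_fderiv, hE.fderiv_eq]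
    · intro y hy
      rw [image_eq_zero_of_notMem_tsupport fun h => hy (hψs h), mul_zero]
  rw [h1, h2, key]

end Euclidean

section Gradient

variable {M : Type*} [MetricSpace M] [ChartedSpace Plane M]
  [RiemannianBundle (fun x : M => TangentSpace (𝓡 2) x)]

instance finiteDimensional_tangentSpace (x : M) : FiniteDimensional ℝ (TangentSpace (𝓡 2) x) :=
  inferInstanceAs (FiniteDimensional ℝ Plane)

instance completeSpace_tangentSpace (x : M) : CompleteSpace (TangentSpace (𝓡 2) x) :=
  FiniteDimensional.complete ℝ _

/-- The pointwise Riemannian gradient: the vector dual to the differential of `u`, which is `0`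
where `u` is not differentiable. -/
def grad (u : M → ℝ) (x : M) : TangentSpace (𝓡 2) x :=
  (InnerProductSpace.toDual ℝ (TangentSpace (𝓡 2) x)).symm (mfderiv (𝓡 2) 𝓘(ℝ, ℝ) u x)

lemma inner_grad (u : M → ℝ) (x : M) (w : TangentSpace (𝓡 2) x) :
    inner ℝ (grad u x) w = mfderiv (𝓡 2) 𝓘(ℝ, ℝ) u x w :=
  InnerProductSpace.toDual_symm_apply

variable [IsManifold (𝓡 2) ∞ M]

lemma mdifferentiableAt_of_chart {u : M → ℝ} {p : M} {y : Plane}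
    (hy : y ∈ (extChartAt (𝓡 2) p).target)
    (hd : DifferentiableAt ℝ (fun y => u (chartPoint p y)) y) :
    MDifferentiableAt (𝓡 2) 𝓘(ℝ, ℝ) u (chartPoint p y) := by
  have hx := chartPoint_mem_source hy
  have h1 : MDifferentiableAt (𝓡 2) 𝓘(ℝ, ℝ)
      ((fun y => u (chartPoint p y)) ∘ extChartAt (𝓡 2) p) (chartPoint p y) := by
    refine MDifferentiableAt.comp _ ?_ (mdifferentiableAt_extChartAt_of_mem hx)
    rw [extChartAt_chartPoint hy]
    exact hd.mdifferentiableAt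
  refine h1.congr_of_eventuallyEq ?_
  filter_upwards [(isOpen_extChartAt_source (I := 𝓡 2) p).mem_nhds hx] with z hz
  simp only [Function.comp]
  rw [chartPoint_extChartAt hz]

lemma hasFDerivAt_comp_chartPoint {u : M → ℝ} {p : M} {y : Plane}
    (hy : y ∈ (extChartAt (𝓡 2) p).target)
    (hd : MDifferentiableAt (𝓡 2) 𝓘(ℝ, ℝ) u (chartPoint p y)) :
    DifferentiableAt ℝ (fun y => u (chartPoint p y)) y ∧ ∀ v,
      fderiv ℝ (fun y => u (chartPoint p y)) y v =
        inner ℝ (grad u (chartPoint p y)) (chartVector p y v) := by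
  have h0 : HasMFDerivAt 𝓘(ℝ, Plane) 𝓘(ℝ, ℝ) (fun y => u (chartPoint p y)) y _ :=
    hd.hasMFDerivAt.comp y (mdifferentiableAt_chartPoint hy).hasMFDerivAt
  refine ⟨mdifferentiableAt_iff_differentiableAt.1 h0.mdifferentiableAt, fun v => ?_⟩
  rw [inner_grad, ← mfderiv_eq_fderiv]
  exact congr($(h0.mfderiv) v)

/-- The square of the norm of a tangent vector in terms of its covariant coordinates. -/
lemma norm_sq_eq_of_inner_chartVector {p : M} {y : Plane}
    (hy : y ∈ (extChartAt (𝓡 2) p).target) (X : TangentSpace (𝓡 2) (chartPoint p y)) :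
    ‖X‖ ^ 2 = (gramMatrix p y 1 1 * inner ℝ X (chartVector p y (EuclideanSpace.single 0 1)) ^ 2
      - 2 * gramMatrix p y 0 1 * inner ℝ X (chartVector p y (EuclideanSpace.single 0 1)) *
        inner ℝ X (chartVector p y (EuclideanSpace.single 1 1))
      + gramMatrix p y 0 0 * inner ℝ X (chartVector p y (EuclideanSpace.single 1 1)) ^ 2) /
        (gramMatrix p y).det := by
  rw [eq_div_iff (det_gramMatrix_pos hy).ne', Matrix.det_fin_two]
  obtain ⟨c, rfl⟩ : ∃ c : Plane, chartVector p y c = X := ⟨_, chartVector_mfderiv hy X⟩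
  have hc : c = c 0 • EuclideanSpace.single 0 1 + c 1 • EuclideanSpace.single 1 1 := by
    ext i; fin_cases i <;> simp
  have hb : ∀ w : Plane, inner ℝ (chartVector p y c) (chartVector p y w) =
      c 0 * inner ℝ (chartVector p y (EuclideanSpace.single 0 1)) (chartVector p y w) +
      c 1 * inner ℝ (chartVector p y (EuclideanSpace.single 1 1)) (chartVector p y w) := by
    intro w
    conv_lhs => rw [hc]
    rw [chartVector_add, chartVector_smul, chartVector_smul, inner_add_left,
      real_inner_smul_left, real_inner_smul_left]
  have h10 : gramMatrix p y 1 0 = gramMatrix p y 0 1 :=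
    real_inner_comm (chartVector p y (EuclideanSpace.single 0 1)) _
  have e (i j : Fin 2) : inner ℝ (chartVector p y (EuclideanSpace.single i 1))
      (chartVector p y (EuclideanSpace.single j 1)) = gramMatrix p y i j := rfl
  rw [norm_chartVector_sq, hb, hb, e, e, e, e, h10]
  ring

variable [IsContMDiffRiemannianBundle (𝓡 2) ∞ Plane (fun x : M => TangentSpace (𝓡 2) x)]
  [IsRiemannianManifold (𝓡 2) M]

lemma locallyLipschitzOn_comp_chartPoint {u : M → ℝ} {C : ℝ≥0} (hu : LipschitzWith C u) (p : M) :
    LocallyLipschitzOn (extChartAt (𝓡 2) p).target (fun y => u (chartPoint p y)) := by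
  intro y hy
  obtain ⟨A, hA⟩ := exists_linear_isometry_frame hy
  obtain ⟨r, hr, hst, hb⟩ := exists_ball_almost_isometry hy hA (κ := 2) one_lt_two
  refine ⟨C * (2 * ‖(A : Plane →L[ℝ] Plane)‖₊), Metric.ball y r,
    mem_nhdsWithin_of_mem_nhds (Metric.ball_mem_nhds y hr), ?_⟩
  refine hu.comp_lipschitzOnWith (LipschitzOnWith.of_dist_le_mul fun z hz z' hz' => ?_)
  refine ((hb z hz).2.2.2 z' hz').1.trans ?_
  have := (A : Plane →L[ℝ] Plane).le_opNorm (z - z')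
  rw [dist_eq_norm]
  push_cast
  rw [mul_assoc]
  exact mul_le_mul_of_nonneg_left this zero_le_two

lemma norm_grad_chartPoint_le {u : M → ℝ} {p : M} {y : Plane}
    (hy : y ∈ (extChartAt (𝓡 2) p).target) {C : ℝ} (hC : 0 ≤ C)
    (hu : ∀ᶠ z in 𝓝 (chartPoint p y),
      |u z - u (chartPoint p y)| ≤ C * dist z (chartPoint p y)) :
    ‖grad u (chartPoint p y)‖ ≤ C := by
  by_cases hd : MDifferentiableAt (𝓡 2) 𝓘(ℝ, ℝ) u (chartPoint p y)
  swap
  · rw [grad, mfderiv_zero_of_not_mdifferentiableAt hd]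
    exact (norm_eq_zero.2 (map_zero _)).trans_le hC
  obtain ⟨A, hA⟩ := exists_linear_isometry_frame hy
  obtain ⟨hf, hf'⟩ := hasFDerivAt_comp_chartPoint hy hd
  have hnorm : ∀ v, ‖A v‖ = ‖chartVector p y v‖ := fun v => by
    rw [← sq_eq_sq₀ (norm_nonneg _) (norm_nonneg _), ← real_inner_self_eq_norm_sq, hA,
      real_inner_self_eq_norm_sq]
  -- The difference quotients of `u` along coordinate lines are bounded by `C` times the speed, up
  -- to a factor `κ` which is arbitrarily close to `1`.
  have key : ∀ κ : ℝ, 1 < κ → ∀ v, |inner ℝ (grad u (chartPoint p y)) (chartVector p y v)| ≤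
      κ * (C * ‖chartVector p y v‖) := by
    intro κ hκ v
    obtain ⟨r, hr, hst, hb⟩ := exists_ball_almost_isometry hy hA hκ
    have hl : HasDerivAt (fun t : ℝ => y + t • v) v 0 := by
      simpa using ((hasDerivAt_id (0 : ℝ)).smul_const v).const_add y
    have hc : HasDerivAt (fun t : ℝ => u (chartPoint p (y + t • v)))
        (fderiv ℝ (fun y => u (chartPoint p y)) y v) 0 :=
      HasFDerivAt.comp_hasDerivAt_of_eq (0 : ℝ) hf.hasFDerivAt hl (by simp)
    rw [← hf' v, ← Real.norm_eq_abs]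
    refine hc.le_of_lip' (by positivity) ?_
    have hin : ∀ᶠ t : ℝ in 𝓝 0, y + t • v ∈ Metric.ball y r :=
      hl.continuousAt.eventually_mem (by simpa using Metric.ball_mem_nhds y hr)
    have hpt : Tendsto (fun t : ℝ => chartPoint p (y + t • v)) (𝓝 0) (𝓝 (chartPoint p y)) := by
      have h1 := ((continuousOn_chartPoint p).continuousAt
        ((isOpen_extChartAt_target (I := 𝓡 2) p).mem_nhds hy)).tendsto
      refine h1.comp ?_
      simpa using hl.continuousAt.tendsto
    filter_upwards [hin, hpt.eventually hu] with t ht h2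
    have h1 := ((hb _ ht).2.2.2 y (Metric.mem_ball_self hr)).1
    rw [add_sub_cancel_left, map_smul, norm_smul, hnorm] at h1
    simp only [zero_smul, add_zero, sub_zero]
    calc ‖u (chartPoint p (y + t • v)) - u (chartPoint p y)‖
        ≤ C * (κ * (‖t‖ * ‖chartVector p y v‖)) :=
          h2.trans (mul_le_mul_of_nonneg_left h1 hC)
      _ = _ := by ring
  have key2 : ∀ v, |inner ℝ (grad u (chartPoint p y)) (chartVector p y v)| ≤
      C * ‖chartVector p y v‖ := by
    intro v
    have ht : Tendsto (fun κ : ℝ => κ * (C * ‖chartVector p y v‖)) (𝓝[>] 1)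
        (𝓝 (1 * (C * ‖chartVector p y v‖))) :=
      ((continuous_id.mul continuous_const).tendsto (1 : ℝ)).mono_left nhdsWithin_le_nhds
    rw [one_mul] at ht
    exact ge_of_tendsto ht (eventually_mem_nhdsWithin.mono fun κ hκ => key κ hκ v)
  obtain ⟨v, hv⟩ : ∃ v : Plane, chartVector p y v = grad u (chartPoint p y) :=
    ⟨_, chartVector_mfderiv hy _⟩
  have h := key2 v
  rw [hv, real_inner_self_eq_norm_sq, abs_of_nonneg (sq_nonneg _), sq] at h
  by_contra hlt
  push Not at hlt
  exact absurd h (not_le.2 (mul_lt_mul_of_pos_right hlt (hC.trans_lt hlt)))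

/-- The norm of the gradient is at most the local Lipschitz constant. -/
lemma norm_grad_le_of_eventually {u : M → ℝ} {x : M} {C : ℝ} (hC : 0 ≤ C)
    (hu : ∀ᶠ z in 𝓝 x, |u z - u x| ≤ C * dist z x) : ‖grad u x‖ ≤ C := by
  have hx := mem_extChartAt_source (I := 𝓡 2) x
  have h := norm_grad_chartPoint_le (u := u) ((extChartAt (𝓡 2) x).map_source hx) hC
  rw [chartPoint_extChartAt hx] at h
  exact h hu

lemma norm_grad_le {u : M → ℝ} {C : ℝ≥0} (hu : LipschitzWith C u) (x : M) : ‖grad u x‖ ≤ C :=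
  norm_grad_le_of_eventually C.coe_nonneg (Eventually.of_forall fun z => hu.dist_le_mul z x)

/-- Rademacher's theorem in a chart. -/
lemma ae_chart_mdifferentiableAt {u : M → ℝ} {C : ℝ≥0} (hu : LipschitzWith C u) (p : M) :
    ∀ᵐ y, y ∈ (extChartAt (𝓡 2) p).target →
      MDifferentiableAt (𝓡 2) 𝓘(ℝ, ℝ) u (chartPoint p y) := by
  filter_upwards [ae_differentiableAt_of_locallyLipschitzOn (isOpen_extChartAt_target (I := 𝓡 2) p)
    (locallyLipschitzOn_comp_chartPoint hu p)] with y h hy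
  exact mdifferentiableAt_of_chart hy (h hy)

lemma ae_chart_inner_grad_eq_fderiv {u : M → ℝ} {C : ℝ≥0} (hu : LipschitzWith C u) (p : M)
    (v : Plane) :
    (fun y => inner ℝ (grad u (chartPoint p y)) (chartVector p y v))
      =ᵐ[volume.restrict (extChartAt (𝓡 2) p).target]
      fun y => fderiv ℝ (fun y => u (chartPoint p y)) y v := by
  rw [EventuallyEq, ae_restrict_iff' (isOpen_extChartAt_target (I := 𝓡 2) p).measurableSet]
  filter_upwards [ae_chart_mdifferentiableAt hu p] with y h hy
  exact ((hasFDerivAt_comp_chartPoint hy (h hy)).2 v).symm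

lemma aestronglyMeasurable_inner_grad {u : M → ℝ} {C : ℝ≥0} (hu : LipschitzWith C u) (p : M)
    (v : Plane) :
    AEStronglyMeasurable (fun y => inner ℝ (grad u (chartPoint p y)) (chartVector p y v))
      (volume.restrict (extChartAt (𝓡 2) p).target) :=
  (measurable_fderiv_apply_const ℝ _ v).aestronglyMeasurable.congr
    (ae_chart_inner_grad_eq_fderiv hu p v).symm

/-- The pointwise gradient of a Lipschitz function is its weak gradient. -/
theorem isWeakGradient_grad {u : M → ℝ} {C : ℝ≥0} (hu : LipschitzWith C u) :
    IsWeakGradient u (grad u) := by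
  intro p
  have ho := isOpen_extChartAt_target (I := 𝓡 2) p
  have hL := locallyLipschitzOn_comp_chartPoint hu p
  refine ⟨hL.continuousOn.locallyIntegrableOn ho.measurableSet, fun v => ⟨?_, ?_⟩⟩
  · intro y hy
    obtain ⟨A, hA⟩ := exists_linear_isometry_frame hy
    obtain ⟨r, hr, hst, hb⟩ := exists_ball_almost_isometry hy hA (κ := 2) one_lt_two
    refine ⟨Metric.ball y r, mem_nhdsWithin_of_mem_nhds (Metric.ball_mem_nhds y hr), ?_⟩
    refine ⟨(aestronglyMeasurable_inner_grad hu p v).mono_measure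
      (Measure.restrict_mono hst le_rfl), .restrict_of_bounded (C := C * (2 * ‖A v‖))
      Metric.isBounded_ball.measure_lt_top ?_⟩
    rw [ae_restrict_iff' Metric.isOpen_ball.measurableSet]
    refine ae_of_all _ fun z hz => (norm_inner_le_norm _ _).trans ?_
    exact mul_le_mul (norm_grad_le hu _) ((hb z hz).1 v) (norm_nonneg _) C.coe_nonneg
  · intro ψ hψ hψc hψs
    rw [setIntegral_mul_fderiv_eq_neg ho hL hψ hψc hψs v]
    congr 1
    refine integral_congr_ae ?_
    filter_upwards [ae_chart_inner_grad_eq_fderiv hu p v] with y hy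
    rw [hy]

variable [MeasurableSpace M] [BorelSpace M] [CompactSpace M]

/-- The weak gradient is unique almost everywhere. -/
lemma IsWeakGradient.ae_eq {u : M → ℝ} {X Y : (x : M) → TangentSpace (𝓡 2) x}
    (hX : IsWeakGradient u X) (hY : IsWeakGradient u Y) : ∀ᵐ x ∂(area M), X x = Y x := by
  refine ae_area fun p => ?_
  have ho := isOpen_extChartAt_target (I := 𝓡 2) p
  have h : ∀ v : Plane, ∀ᵐ y, y ∈ (extChartAt (𝓡 2) p).target →
      inner ℝ (X (chartPoint p y)) (chartVector p y v) -
        inner ℝ (Y (chartPoint p y)) (chartVector p y v) = 0 := by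
    intro v
    obtain ⟨hXi, hX'⟩ := (hX p).2 v
    obtain ⟨hYi, hY'⟩ := (hY p).2 v
    refine ho.ae_eq_zero_of_integral_contDiff_smul_eq_zero (hXi.sub hYi) fun g hg hgc hgs => ?_
    have hint : ∀ f : Plane → ℝ, LocallyIntegrableOn f (extChartAt (𝓡 2) p).target →
        IntegrableOn (fun y => f y * g y) (extChartAt (𝓡 2) p).target := by
      intro f hf
      have h1 : IntegrableOn f (tsupport g) := hf.integrableOn_compact_subset hgs hgc
      have h2 : IntegrableOn (fun y => f y * g y) (tsupport g) :=
        h1.mul_continuousOn hg.continuous.continuousOn hgc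
      refine h2.of_forall_sdiff_eq_zero ho.measurableSet fun y hy => ?_
      rw [image_eq_zero_of_notMem_tsupport hy.2, mul_zero]
    have h3 : ∫ y in (extChartAt (𝓡 2) p).target,
        (inner ℝ (X (chartPoint p y)) (chartVector p y v) * g y -
        inner ℝ (Y (chartPoint p y)) (chartVector p y v) * g y) = 0 := by
      rw [integral_sub (hint _ hXi) (hint _ hYi), sub_eq_zero]
      exact neg_injective ((hX' g hg hgc hgs).symm.trans (hY' g hg hgc hgs))
    rw [← h3, setIntegral_eq_integral_of_forall_compl_eq_zero]
    · refine integral_congr_ae (ae_of_all _ fun y => ?_)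
      simp only [smul_eq_mul]
      ring
    · intro y hy
      rw [image_eq_zero_of_notMem_tsupport fun h => hy (hgs h)]
      simp
  filter_upwards [h (EuclideanSpace.single 0 1), h (EuclideanSpace.single 1 1)] with y h0 h1 hy
  have hz := norm_sq_eq_of_inner_chartVector hy (X (chartPoint p y) - Y (chartPoint p y))
  rw [inner_sub_left, inner_sub_left, h0 hy, h1 hy] at hz
  simpa [sub_eq_zero] using hz

lemma weakGradient_ae_eq_grad {u : M → ℝ} {C : ℝ≥0} (hu : LipschitzWith C u) :
    ∀ᵐ x ∂(area M), weakGradient u x = grad u x := by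
  have h : ∃ X, IsWeakGradient u X := ⟨_, isWeakGradient_grad hu⟩
  rw [weakGradient, dif_pos h]
  exact IsWeakGradient.ae_eq h.choose_spec (isWeakGradient_grad hu)

lemma ae_mdifferentiableAt {u : M → ℝ} {C : ℝ≥0} (hu : LipschitzWith C u) :
    ∀ᵐ x ∂(area M), MDifferentiableAt (𝓡 2) 𝓘(ℝ, ℝ) u x :=
  ae_area (ae_chart_mdifferentiableAt hu)

/-- The norm of the gradient is measurable, as an expression in the coordinate derivatives and the
Gram matrix. -/
lemma aemeasurable_norm_grad {u : M → ℝ} {C : ℝ≥0} (hu : LipschitzWith C u) :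
    AEMeasurable (fun x => ‖grad u x‖) (area M) := by
  refine aemeasurable_area fun p => ?_
  have ho := measurableSet_target p
  have hg : ∀ i j, AEMeasurable (fun y => gramMatrix p y i j)
      (volume.restrict (extChartAt (𝓡 2) p).target) := fun i j =>
    (continuousOn_gramMatrix p i j).aemeasurable ho
  have hb := fun v => (aestronglyMeasurable_inner_grad hu p v).aemeasurable
  have hdet : AEMeasurable (fun y => (gramMatrix p y).det)
      (volume.restrict (extChartAt (𝓡 2) p).target) := by
    simp only [Matrix.det_fin_two]
    exact ((hg 0 0).mul (hg 1 1)).sub ((hg 0 1).mul (hg 1 0))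
  have hm := (((((hg 1 1).mul ((hb (EuclideanSpace.single 0 1)).pow_const 2)).sub
    ((((hg 0 1).const_mul 2).mul (hb (EuclideanSpace.single 0 1))).mul
      (hb (EuclideanSpace.single 1 1)))).add
    ((hg 0 0).mul ((hb (EuclideanSpace.single 1 1)).pow_const 2))).div hdet).sqrt
  refine hm.congr ?_
  rw [EventuallyEq, ae_restrict_iff' ho]
  refine ae_of_all _ fun y hy => ?_
  rw [← Real.sqrt_sq (norm_nonneg (grad u (chartPoint p y))), norm_sq_eq_of_inner_chartVector hy]
  rfl

/-- Lipschitz functions on a compact surface of finite area are in `H¹`. -/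
theorem memH1_of_lipschitzWith [IsFiniteMeasure (area M)] {u : M → ℝ} {C : ℝ≥0}
    (hu : LipschitzWith C u) : MemH1 u := by
  obtain ⟨B, hB⟩ := isCompact_univ.exists_bound_of_continuousOn hu.continuous.continuousOn
  refine ⟨MemLp.of_bound hu.continuous.aestronglyMeasurable B
    (ae_of_all _ fun x => hB x (mem_univ x)), grad u, isWeakGradient_grad hu,
    MemLp.of_bound (aemeasurable_norm_grad hu).aestronglyMeasurable C (ae_of_all _ fun x => ?_)⟩
  rw [norm_norm]
  exact norm_grad_le hu x

end Gradient

/-! ### Integrals of inverse distances, and the functions attached to barycenters -/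

section Potential

variable {M : Type*} [MetricSpace M] [MeasurableSpace M] [BorelSpace M]

lemma integrable_and_integral_le_of_lintegral_le {μ : Measure M} {f : M → ℝ} (hf : Continuous f)
    (h0 : ∀ x, 0 ≤ f x) {c : ℝ} (hc : 0 ≤ c) (h : ∫⁻ x, ENNReal.ofReal (f x) ∂μ ≤ ENNReal.ofReal c) :
    Integrable f μ ∧ ∫ x, f x ∂μ ≤ c := by
  constructor
  · refine ⟨hf.aestronglyMeasurable, ?_⟩
    rw [hasFiniteIntegral_iff_ofReal (ae_of_all _ h0)]
    exact h.trans_lt ENNReal.ofReal_lt_top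
  · rw [integral_eq_lintegral_of_nonneg_ae (ae_of_all _ h0) hf.aestronglyMeasurable]
    exact (ENNReal.toReal_mono ENNReal.ofReal_ne_top h).trans_eq (ENNReal.toReal_ofReal hc)

lemma continuous_inv_max_dist {ε : ℝ} (hε : 0 < ε) (x : M) :
    Continuous fun y => (max ε (dist y x))⁻¹ :=
  (continuous_const.max (continuous_id.dist continuous_const)).inv₀
    fun _ => (hε.trans_le (le_max_left _ _)).ne'

variable {μ : Measure M} [IsProbabilityMeasure μ] {A r₀ : ℝ} {x : M}

/-- The integral of the truncated `d⁻²` grows at most like `2 A log L` when discs of radius `s`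
have measure at most `A s²`; this is where the constant in front of the energy comes from. The
bound is the layer cake formula. -/
lemma integral_inv_max_dist_sq_le (hA : 0 ≤ A) (hr₀ : 0 < r₀) (hr₁ : r₀ ≤ 1)
    (h : ∀ s, 0 < s → s < r₀ → μ (Metric.ball x s) ≤ ENNReal.ofReal (A * s ^ 2))
    {L : ℝ} (hL : 1 ≤ L) :
    Integrable (fun y => (max L⁻¹ (dist y x))⁻¹ ^ 2) μ ∧
      ∫ y, (max L⁻¹ (dist y x))⁻¹ ^ 2 ∂μ ≤ (r₀ ^ 2)⁻¹ + 2 * A * Real.log L := by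
  have hL0 : 0 < L := by linarith
  have hlog : 0 ≤ Real.log L := Real.log_nonneg hL
  have hcont : Continuous fun y => (max L⁻¹ (dist y x))⁻¹ ^ 2 :=
    (continuous_inv_max_dist (inv_pos.2 hL0) x).pow 2
  refine integrable_and_integral_le_of_lintegral_le hcont (fun y => sq_nonneg _)
    (by positivity) ?_
  rw [lintegral_eq_lintegral_meas_lt μ (ae_of_all _ fun y => sq_nonneg _) hcont.aemeasurable]
  -- The superlevel set at height `t` is a disc of radius `t ^ (-1/2)`, which is small enough for the
  -- area bound when `s₀ < t`; it is empty when `L ^ 2 ≤ t`.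
  set s₀ := (r₀ ^ 2)⁻¹ with hs₀
  have hs₀1 : 1 ≤ s₀ := (one_le_inv₀ (by positivity)).2 (by nlinarith)
  have hsub : Ioi (0 : ℝ) ⊆ Ioc 0 s₀ ∪ (Ioc s₀ (L ^ 2) ∪ Ioi (L ^ 2)) := by
    intro t ht
    rcases le_or_gt t s₀ with h1 | h1
    · exact Or.inl ⟨ht, h1⟩
    rcases le_or_gt t (L ^ 2) with h2 | h2
    · exact Or.inr (Or.inl ⟨h1, h2⟩)
    · exact Or.inr (Or.inr h2)
  have hmax : ∀ y, 0 < max L⁻¹ (dist y x) := fun y => (inv_pos.2 hL0).trans_le (le_max_left _ _)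
  have h1 : ∫⁻ t in Ioc 0 s₀, μ {y | t < (max L⁻¹ (dist y x))⁻¹ ^ 2} ≤ ENNReal.ofReal s₀ := by
    calc ∫⁻ t in Ioc 0 s₀, μ {y | t < (max L⁻¹ (dist y x))⁻¹ ^ 2}
        ≤ ∫⁻ t in Ioc 0 s₀, 1 := lintegral_mono fun t => prob_le_one
      _ = _ := by simp
  have h2 : ∫⁻ t in Ioc s₀ (L ^ 2), μ {y | t < (max L⁻¹ (dist y x))⁻¹ ^ 2} ≤
      ENNReal.ofReal (2 * A * Real.log L) := by
    rcases le_or_gt (L ^ 2) s₀ with hle | hlt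
    · rw [Ioc_eq_empty (not_lt.2 hle)]; simp
    have hi : IntegrableOn (fun t => A * t⁻¹) (Ioc s₀ (L ^ 2)) :=
      ((intervalIntegrable_iff_integrableOn_Ioc_of_le hlt.le).1
        (intervalIntegral.intervalIntegrable_inv (fun t ht h0 => by
          rw [uIcc_of_le hlt.le, show t = 0 from h0] at ht
          linarith [ht.1]) continuousOn_id)).const_mul A
    calc ∫⁻ t in Ioc s₀ (L ^ 2), μ {y | t < (max L⁻¹ (dist y x))⁻¹ ^ 2}
        ≤ ∫⁻ t in Ioc s₀ (L ^ 2), ENNReal.ofReal (A * t⁻¹) := by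
          refine setLIntegral_mono' measurableSet_Ioc fun t ht => ?_
          have ht0 : 0 < t := by linarith [ht.1]
          have hst : 0 < Real.sqrt t := Real.sqrt_pos.2 ht0
          have h3 : {y | t < (max L⁻¹ (dist y x))⁻¹ ^ 2} ⊆ Metric.ball x (Real.sqrt t)⁻¹ := by
            intro y hy
            have h4 : Real.sqrt t < (max L⁻¹ (dist y x))⁻¹ :=
              (Real.sqrt_lt' (inv_pos.2 (hmax y))).2 hy
            rw [Metric.mem_ball]
            exact (le_max_right _ _).trans_lt ((lt_inv_comm₀ hst (hmax y)).1 h4)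
          have h5 : (Real.sqrt t)⁻¹ < r₀ := by
            rw [inv_lt_comm₀ hst hr₀]
            refine Real.lt_sqrt_of_sq_lt ?_
            rw [inv_pow]
            exact ht.1
          refine (measure_mono h3).trans ((h _ (inv_pos.2 hst) h5).trans_eq ?_)
          rw [inv_pow, Real.sq_sqrt ht0.le]
      _ = ENNReal.ofReal (∫ t in Ioc s₀ (L ^ 2), A * t⁻¹) := by
          rw [ofReal_integral_eq_lintegral_ofReal hi]
          rw [EventuallyLE, ae_restrict_iff' measurableSet_Ioc]
          refine ae_of_all _ fun t ht => ?_
          have ht0 : 0 < t := by linarith [ht.1]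
          simp only [Pi.zero_apply]
          positivity
      _ ≤ _ := by
          refine ENNReal.ofReal_le_ofReal ?_
          rw [integral_const_mul, ← intervalIntegral.integral_of_le hlt.le,
            integral_inv_of_pos (by linarith) (by positivity),
            Real.log_div (by positivity) (by positivity), Real.log_pow]
          have := Real.log_nonneg hs₀1
          push_cast
          nlinarith
  have h3 : ∫⁻ t in Ioi (L ^ 2), μ {y | t < (max L⁻¹ (dist y x))⁻¹ ^ 2} = 0 := by
    rw [setLIntegral_congr_fun measurableSet_Ioi (g := fun _ => 0), lintegral_zero]
    intro t ht
    have : {y | t < (max L⁻¹ (dist y x))⁻¹ ^ 2} = ∅ := by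
      refine eq_empty_of_forall_notMem fun y hy => ?_
      have h4 : (max L⁻¹ (dist y x))⁻¹ ≤ L := inv_le_of_inv_le₀ hL0 (le_max_left _ _)
      have h5 : (max L⁻¹ (dist y x))⁻¹ ^ 2 ≤ L ^ 2 :=
        pow_le_pow_left₀ (inv_pos.2 (hmax y)).le h4 2
      exact absurd (hy.trans_le h5) (not_lt.2 (le_of_lt ht))
    change μ {y | t < (max L⁻¹ (dist y x))⁻¹ ^ 2} = 0
    rw [this, measure_empty]
  calc ∫⁻ t in Ioi 0, μ {y | t < (max L⁻¹ (dist y x))⁻¹ ^ 2}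
      ≤ ∫⁻ t in Ioc 0 s₀ ∪ (Ioc s₀ (L ^ 2) ∪ Ioi (L ^ 2)),
        μ {y | t < (max L⁻¹ (dist y x))⁻¹ ^ 2} := lintegral_mono_set hsub
    _ ≤ ENNReal.ofReal s₀ + (ENNReal.ofReal (2 * A * Real.log L) + 0) := by
        refine (lintegral_union_le _ _ _).trans (add_le_add h1 ?_)
        exact (lintegral_union_le _ _ _).trans (add_le_add h2 h3.le)
    _ = _ := by rw [add_zero, ← ENNReal.ofReal_add (by positivity) (by positivity)]

/-- The integral of the truncated `d⁻¹` is bounded independently of the truncation. -/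
lemma integral_inv_max_dist_le (hA : 0 ≤ A) (hr₀ : 0 < r₀)
    (h : ∀ s, 0 < s → s < r₀ → μ (Metric.ball x s) ≤ ENNReal.ofReal (A * s ^ 2))
    {ε : ℝ} (hε : 0 < ε) :
    Integrable (fun y => (max ε (dist y x))⁻¹) μ ∧
      ∫ y, (max ε (dist y x))⁻¹ ∂μ ≤ r₀⁻¹ + A * r₀ := by
  have hcont := continuous_inv_max_dist hε x
  have hmax : ∀ y, 0 < max ε (dist y x) := fun y => hε.trans_le (le_max_left _ _)
  refine integrable_and_integral_le_of_lintegral_le hcont (fun y => (inv_pos.2 (hmax y)).le)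
    (by positivity) ?_
  rw [lintegral_eq_lintegral_meas_lt μ (ae_of_all _ fun y => (inv_pos.2 (hmax y)).le)
    hcont.aemeasurable]
  have hs₀ : 0 < r₀⁻¹ := inv_pos.2 hr₀
  have h1 : ∫⁻ t in Ioc 0 r₀⁻¹, μ {y | t < (max ε (dist y x))⁻¹} ≤ ENNReal.ofReal r₀⁻¹ := by
    calc ∫⁻ t in Ioc 0 r₀⁻¹, μ {y | t < (max ε (dist y x))⁻¹}
        ≤ ∫⁻ t in Ioc 0 r₀⁻¹, 1 := lintegral_mono fun t => prob_le_one
      _ = _ := by simp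
  have hi : IntegrableOn (fun t => A * t ^ (-2 : ℝ)) (Ioi r₀⁻¹) :=
    (integrableOn_Ioi_rpow_of_lt (by norm_num) hs₀).const_mul A
  have h2 : ∫⁻ t in Ioi r₀⁻¹, μ {y | t < (max ε (dist y x))⁻¹} ≤ ENNReal.ofReal (A * r₀) := by
    calc ∫⁻ t in Ioi r₀⁻¹, μ {y | t < (max ε (dist y x))⁻¹}
        ≤ ∫⁻ t in Ioi r₀⁻¹, ENNReal.ofReal (A * t ^ (-2 : ℝ)) := by
          refine setLIntegral_mono' measurableSet_Ioi fun t ht => ?_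
          have ht0 : 0 < t := hs₀.trans ht
          have h3 : {y | t < (max ε (dist y x))⁻¹} ⊆ Metric.ball x t⁻¹ := by
            intro y hy
            rw [Metric.mem_ball]
            exact (le_max_right _ _).trans_lt ((lt_inv_comm₀ ht0 (hmax y)).1 hy)
          refine (measure_mono h3).trans
            ((h _ (inv_pos.2 ht0) ((inv_lt_comm₀ ht0 hr₀).2 ht)).trans_eq ?_)
          rw [Real.rpow_neg ht0.le, inv_pow, Real.rpow_two]
      _ = ENNReal.ofReal (∫ t in Ioi r₀⁻¹, A * t ^ (-2 : ℝ)) := by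
          rw [ofReal_integral_eq_lintegral_ofReal hi]
          rw [EventuallyLE, ae_restrict_iff' measurableSet_Ioi]
          refine ae_of_all _ fun t ht => ?_
          have ht0 : 0 < t := hs₀.trans ht
          simp only [Pi.zero_apply]
          positivity
      _ = _ := by
          rw [integral_const_mul, integral_Ioi_rpow_of_lt (by norm_num) hs₀]
          norm_num [Real.rpow_neg_one]
  calc ∫⁻ t in Ioi 0, μ {y | t < (max ε (dist y x))⁻¹}
      = ∫⁻ t in Ioc 0 r₀⁻¹ ∪ Ioi r₀⁻¹, μ {y | t < (max ε (dist y x))⁻¹} := by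
        rw [Ioc_union_Ioi_eq_Ioi hs₀.le]
    _ ≤ ENNReal.ofReal r₀⁻¹ + ENNReal.ofReal (A * r₀) :=
        (lintegral_union_le _ _ _).trans (add_le_add h1 h2)
    _ = _ := by rw [← ENNReal.ofReal_add (by positivity) (by positivity)]

end Potential

section LogBubble

/-- Logarithms of weighted means differ at most as much as those of the terms. This reduces the
regularity of a bubble to that of its terms, uniformly in the weights. -/
lemma abs_log_sum_sub_log_sum_le {K : ℕ} {t a b : Fin K → ℝ} (ht : ∀ k, 0 ≤ t k)
    (hs : ∑ k, t k = 1) (ha : ∀ k, 0 < a k) (hb : ∀ k, 0 < b k) {c : ℝ}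
    (h : ∀ k, |Real.log (a k) - Real.log (b k)| ≤ c) :
    |Real.log (∑ k, t k * a k) - Real.log (∑ k, t k * b k)| ≤ c := by
  have hpos : ∀ a : Fin K → ℝ, (∀ k, 0 < a k) → 0 < ∑ k, t k * a k := by
    intro a ha
    obtain ⟨k, hk⟩ : ∃ k, t k ≠ 0 := by
      by_contra! h0
      simp [h0] at hs
    exact Finset.sum_pos' (fun k _ => mul_nonneg (ht k) (ha k).le)
      ⟨k, Finset.mem_univ k, mul_pos (lt_of_le_of_ne (ht k) hk.symm) (ha k)⟩
  have main : ∀ a b : Fin K → ℝ, (∀ k, 0 < a k) → (∀ k, 0 < b k) →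
      (∀ k, |Real.log (a k) - Real.log (b k)| ≤ c) →
      Real.log (∑ k, t k * a k) - Real.log (∑ k, t k * b k) ≤ c := by
    intro a b ha hb h
    have h1 : ∑ k, t k * a k ≤ Real.exp c * ∑ k, t k * b k := by
      rw [Finset.mul_sum]
      refine Finset.sum_le_sum fun k _ => ?_
      have h2 : a k ≤ Real.exp c * b k := by
        have := (abs_le.1 (h k)).2
        rw [← Real.log_le_log_iff (ha k) (mul_pos (Real.exp_pos c) (hb k)),
          Real.log_mul (Real.exp_pos c).ne' (hb k).ne', Real.log_exp]
        linarith
      nlinarith [ht k]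
    have h3 := Real.log_le_log (hpos a ha) h1
    rw [Real.log_mul (Real.exp_pos c).ne' (hpos b hb).ne', Real.log_exp] at h3
    linarith
  rw [abs_le]
  constructor
  · have := main b a hb ha fun k => by rw [abs_sub_comm]; exact h k
    linarith
  · exact main a b ha hb h

/-- The profile of a bubble: the logarithm of `(1 + (r s)²)⁻²`. -/
def profile (r s : ℝ) : ℝ := Real.log (1 / (1 + (r * s) ^ 2) ^ 2)

lemma profile_eq (r s : ℝ) : profile r s = -2 * Real.log (1 + (r * s) ^ 2) := by
  rw [profile, one_div, Real.log_inv, Real.log_pow]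
  push_cast; ring

lemma hasDerivAt_profile (r s : ℝ) :
    HasDerivAt (profile r) (-(4 * r ^ 2 * s / (1 + (r * s) ^ 2))) s := by
  have h1 : HasDerivAt (fun s => 1 + (r * s) ^ 2) (2 * (r * s) * r) s := by
    simpa using (((hasDerivAt_id s).const_mul r).pow 2).const_add 1
  have h2 := (h1.log (by positivity)).const_mul (-2)
  rw [show profile r = fun s => -2 * Real.log (1 + (r * s) ^ 2) from funext (profile_eq r)]
  refine h2.congr_deriv ?_
  field_simp
  ring

lemma slope_profile_le (r s : ℝ) (hr : 0 ≤ r) :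
    4 * r ^ 2 * s / (1 + (r * s) ^ 2) ≤ 2 * r := by
  rw [div_le_iff₀ (by positivity)]
  nlinarith [mul_nonneg hr (sq_nonneg (r * s - 1))]

lemma slope_profile_le_inv_max (r s : ℝ) (hr : 0 ≤ r) :
    4 * r ^ 2 * s / (1 + (r * s) ^ 2) ≤ 4 * (max (max 1 r)⁻¹ s)⁻¹ := by
  have hL : 0 < max 1 r := lt_max_of_lt_left one_pos
  rcases le_or_gt s (max 1 r)⁻¹ with h | h
  · rw [max_eq_left h, inv_inv]
    have := slope_profile_le r s hr
    have := le_max_right 1 r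
    linarith
  · rw [max_eq_right h.le]
    have hs0 : 0 < s := (inv_pos.2 hL).trans h
    rw [div_le_iff₀ (by positivity), ← div_eq_mul_inv, div_mul_eq_mul_div, le_div_iff₀ hs0]
    nlinarith

lemma lipschitzWith_profile (r : ℝ) (hr : 0 ≤ r) : LipschitzWith (2 * ⟨r, hr⟩) (profile r) := by
  refine lipschitzWith_of_nnnorm_deriv_le (fun s => (hasDerivAt_profile r s).differentiableAt)
    fun s => ?_
  rw [(hasDerivAt_profile r s).deriv, ← NNReal.coe_le_coe, coe_nnnorm, norm_neg, Real.norm_eq_abs,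
    abs_div, abs_mul, abs_of_pos (show 0 < 1 + (r * s) ^ 2 by positivity),
    abs_of_nonneg (show 0 ≤ 4 * r ^ 2 by positivity)]
  have := slope_profile_le r |s| hr
  rwa [mul_pow, sq_abs, ← mul_pow] at this

variable {M : Type*} [MetricSpace M] {K : ℕ} {r : ℝ} {t : Fin K → ℝ} {x : Fin K → M}

/-- The bubble `log ∑ tₖ (1 + (r d(·, xₖ))²)⁻²` attached to weights `tₖ` and points `xₖ`. -/
def logBubble (r : ℝ) (t : Fin K → ℝ) (x : Fin K → M) (z : M) : ℝ :=
  Real.log (∑ k, t k / (1 + (r * dist z (x k)) ^ 2) ^ 2)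

lemma logBubble_eq (z : M) :
    logBubble r t x z = Real.log (∑ k, t k * (1 / (1 + (r * dist z (x k)) ^ 2) ^ 2)) := by
  simp only [logBubble, mul_one_div]

lemma abs_logBubble_sub_le (ht : ∀ k, 0 ≤ t k) (hs : ∑ k, t k = 1) {z z' : M} {c : ℝ}
    (h : ∀ k, |profile r (dist z (x k)) - profile r (dist z' (x k))| ≤ c) :
    |logBubble r t x z - logBubble r t x z'| ≤ c := by
  rw [logBubble_eq, logBubble_eq]
  exact abs_log_sum_sub_log_sum_le ht hs (fun k => by positivity) (fun k => by positivity) h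

lemma lipschitzWith_logBubble (ht : ∀ k, 0 ≤ t k) (hs : ∑ k, t k = 1) (hr : 0 ≤ r) :
    LipschitzWith (2 * ⟨r, hr⟩) (logBubble r t x) := by
  refine LipschitzWith.of_dist_le_mul fun z z' => ?_
  rw [Real.dist_eq]
  refine abs_logBubble_sub_le ht hs fun k => ?_
  have h := (lipschitzWith_profile r hr).dist_le_mul (dist z (x k)) (dist z' (x k))
  rw [Real.dist_eq, Real.dist_eq] at h
  exact h.trans (mul_le_mul_of_nonneg_left (abs_dist_sub_le z z' (x k)) (NNReal.coe_nonneg _))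

/-- The slope of a bubble at a point is at most the largest slope of its terms. -/
lemma eventually_abs_logBubble_sub_le (ht : ∀ k, 0 ≤ t k) (hs : ∑ k, t k = 1) (z : M) {c : ℝ}
    (h : ∀ k, 4 * r ^ 2 * dist z (x k) / (1 + (r * dist z (x k)) ^ 2) < c) :
    ∀ᶠ z' in 𝓝 z, |logBubble r t x z' - logBubble r t x z| ≤ c * dist z' z := by
  have hk : ∀ k, ∀ᶠ z' in 𝓝 z,
      |profile r (dist z' (x k)) - profile r (dist z (x k))| ≤ c * dist z' z := by
    intro k
    have hc0 : 0 ≤ c := le_trans (by positivity) (h k).le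
    have hd := (hasDerivAt_profile r (dist z (x k))).isLittleO
    have h2 := hd.bound (sub_pos.2 (h k))
    have hcont : Tendsto (fun z' => dist z' (x k)) (𝓝 z) (𝓝 (dist z (x k))) :=
      (continuous_id.dist continuous_const).tendsto z
    filter_upwards [hcont.eventually h2] with z' hz'
    set s := dist z (x k)
    set s' := dist z' (x k)
    set m := 4 * r ^ 2 * s / (1 + (r * s) ^ 2)
    have hm : 0 ≤ m := by positivity
    simp only [smul_eq_mul, Real.norm_eq_abs] at hz'
    have h3 : |profile r s' - profile r s| ≤ c * |s' - s| := by
      have h4 : |(s' - s) * -m| = m * |s' - s| := by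
        rw [abs_mul, abs_neg, abs_of_nonneg hm, mul_comm]
      have h5 := abs_add_le (profile r s' - profile r s - (s' - s) * -m) ((s' - s) * -m)
      rw [sub_add_cancel, h4] at h5
      linarith
    exact h3.trans (mul_le_mul_of_nonneg_left (abs_dist_sub_le z' z (x k)) hc0)
  filter_upwards [eventually_all.2 hk] with z' hz'
  exact abs_logBubble_sub_le ht hs hz'

lemma sum_profile_pos (ht : ∀ k, 0 ≤ t k) (hs : ∑ k, t k = 1) (z : M) :
    0 < ∑ k, t k / (1 + (r * dist z (x k)) ^ 2) ^ 2 := by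
  obtain ⟨k, hk⟩ : ∃ k, t k ≠ 0 := by
    by_contra! h0
    simp [h0] at hs
  exact Finset.sum_pos' (fun k _ => div_nonneg (ht k) (by positivity))
    ⟨k, Finset.mem_univ k, div_pos (lt_of_le_of_ne (ht k) hk.symm) (by positivity)⟩

lemma logBubble_le_of_forall (ht : ∀ k, 0 ≤ t k) (hs : ∑ k, t k = 1) {z : M} {c : ℝ}
    (h : ∀ k, profile r (dist z (x k)) ≤ c) : logBubble r t x z ≤ c := by
  rw [logBubble, Real.log_le_iff_le_exp (sum_profile_pos ht hs z)]
  calc ∑ k, t k / (1 + (r * dist z (x k)) ^ 2) ^ 2 ≤ ∑ k, t k * Real.exp c := by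
        refine Finset.sum_le_sum fun k _ => ?_
        rw [div_eq_mul_one_div]
        refine mul_le_mul_of_nonneg_left ?_ (ht k)
        exact (Real.log_le_iff_le_exp (by positivity)).1 (h k)
    _ = Real.exp c := by rw [← Finset.sum_mul, hs, one_mul]

lemma le_logBubble_of_forall (ht : ∀ k, 0 ≤ t k) (hs : ∑ k, t k = 1) {z : M} {c : ℝ}
    (h : ∀ k, c ≤ profile r (dist z (x k))) : c ≤ logBubble r t x z := by
  rw [logBubble, Real.le_log_iff_exp_le (sum_profile_pos ht hs z)]
  calc Real.exp c = ∑ k, t k * Real.exp c := by rw [← Finset.sum_mul, hs, one_mul]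
    _ ≤ ∑ k, t k / (1 + (r * dist z (x k)) ^ 2) ^ 2 := by
        refine Finset.sum_le_sum fun k _ => ?_
        rw [div_eq_mul_one_div]
        refine mul_le_mul_of_nonneg_left ?_ (ht k)
        exact (Real.le_log_iff_exp_le (by positivity)).1 (h k)

/-- The mean of `1/d` being bounded, this says that the profile is at most `-4 log L` on average,
for `L = max 1 r`. -/
lemma profile_le_inv_max (r s : ℝ) :
    profile r s ≤ -4 * Real.log (max 1 r) + 4 * (max (max 1 r)⁻¹ s)⁻¹ := by
  have hL : 0 < max 1 r := lt_max_of_lt_left one_pos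
  set m := max (max 1 r)⁻¹ s with hm
  have hm0 : 0 < m := (inv_pos.2 hL).trans_le (le_max_left _ _)
  rw [profile_eq]
  rcases le_or_gt r 1 with h | h
  · rw [max_eq_left h, Real.log_one]
    have : 0 ≤ Real.log (1 + (r * s) ^ 2) := Real.log_nonneg (by nlinarith [sq_nonneg (r * s)])
    have : 0 < m⁻¹ := inv_pos.2 hm0
    linarith
  · rw [max_eq_right h.le] at hm ⊢
    have hr : 0 < r := by linarith
    have h1 : (r * m) ^ 2 ≤ 1 + (r * s) ^ 2 := by
      rcases max_choice r⁻¹ s with h2 | h2 <;> rw [hm, h2]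
      · rw [mul_inv_cancel₀ hr.ne']; nlinarith [sq_nonneg (r * s)]
      · linarith
    have h2 := Real.log_le_log (by positivity) h1
    rw [Real.log_pow, Real.log_mul hr.ne' hm0.ne'] at h2
    have h3 : -Real.log m ≤ m⁻¹ := by
      rw [← Real.log_inv]
      have := Real.log_le_sub_one_of_pos (inv_pos.2 hm0)
      linarith
    push_cast at h2
    linarith

/-- At bounded distance the profile is at least `-4 log L`, up to a constant. -/
lemma le_profile (hr : 0 ≤ r) {s D : ℝ} (hs : 0 ≤ s) (hD : s ≤ D) :
    -4 * Real.log (max 1 r) - 2 * Real.log (1 + D ^ 2) ≤ profile r s := by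
  have hL : 1 ≤ max 1 r := le_max_left _ _
  have h1 : 1 + (r * s) ^ 2 ≤ max 1 r ^ 2 * (1 + D ^ 2) := by
    have h2 : (r * s) ^ 2 ≤ (max 1 r * D) ^ 2 :=
      pow_le_pow_left₀ (by positivity) (mul_le_mul (le_max_right _ _) hD hs (by linarith)) 2
    nlinarith
  have h2 := Real.log_le_log (by positivity) h1
  rw [Real.log_mul (by positivity) (by positivity), Real.log_pow] at h2
  rw [profile_eq]
  push_cast at h2
  linarith

/-- Away from the centre the profile is at most `-4 log L`, up to a constant. -/
lemma profile_le_of_le (hr : 0 ≤ r) {s c : ℝ} (hc : 0 < c) (hc1 : c ≤ 1) (hs : c ≤ s) :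
    profile r s ≤ -4 * Real.log (max 1 r) - 4 * Real.log c := by
  have hL : 1 ≤ max 1 r := le_max_left _ _
  have h1 : (max 1 r * c) ^ 2 ≤ 1 + (r * s) ^ 2 := by
    rcases max_choice 1 r with h2 | h2 <;> rw [h2]
    · nlinarith [sq_nonneg (r * s)]
    · have : (r * c) ^ 2 ≤ (r * s) ^ 2 :=
        pow_le_pow_left₀ (by positivity) (mul_le_mul_of_nonneg_left hs hr) 2
      linarith
  have h2 := Real.log_le_log (by positivity) h1
  rw [Real.log_pow, Real.log_mul (by positivity) hc.ne'] at h2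
  rw [profile_eq]
  push_cast at h2
  linarith

end LogBubble

/-! ### Energy densities and logarithmic terms -/

section Gradients

variable {M : Type*} [MetricSpace M] [ChartedSpace Plane M] [IsManifold (𝓡 2) ∞ M]
  [RiemannianBundle (fun x : M => TangentSpace (𝓡 2) x)]

lemma grad_sub_const_mul {f g : M → ℝ} {z : M} (hf : MDifferentiableAt (𝓡 2) 𝓘(ℝ, ℝ) f z)
    (hg : MDifferentiableAt (𝓡 2) 𝓘(ℝ, ℝ) g z) (c : ℝ) :
    grad (fun z => f z - c * g z) z = grad f z - c • grad g z := by
  refine ext_inner_right ℝ fun w => ?_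
  have h : HasMFDerivAt (𝓡 2) 𝓘(ℝ, ℝ) (fun z => f z - c * g z) z _ :=
    hf.hasMFDerivAt.sub (hg.hasMFDerivAt.const_smul c)
  rw [inner_sub_left, real_inner_smul_left, inner_grad, inner_grad, inner_grad]
  exact congr($(h.mfderiv) w)

lemma exists_lipschitzWith_sub_const_mul {f g : M → ℝ} {C D : ℝ≥0} (hf : LipschitzWith C f)
    (hg : LipschitzWith D g) (c : ℝ) : ∃ E, LipschitzWith E fun z => f z - c * g z :=
  ⟨_, hf.sub ((lipschitzWith_smul c).comp hg)⟩

variable [IsContMDiffRiemannianBundle (𝓡 2) ∞ Plane (fun x : M => TangentSpace (𝓡 2) x)]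
  [IsRiemannianManifold (𝓡 2) M]

section Slope

variable {K : ℕ} {r : ℝ} {t : Fin K → ℝ} {x : Fin K → M}

lemma norm_grad_logBubble_le (ht : ∀ k, 0 ≤ t k) (hs : ∑ k, t k = 1) {z : M} {c : ℝ} (hc : 0 ≤ c)
    (h : ∀ k, 4 * r ^ 2 * dist z (x k) / (1 + (r * dist z (x k)) ^ 2) ≤ c) :
    ‖grad (logBubble r t x) z‖ ≤ c :=
  le_of_forall_gt_imp_ge_of_dense fun _ hc' => norm_grad_le_of_eventually (hc.trans hc'.le)
    (eventually_abs_logBubble_sub_le ht hs z fun k => (h k).trans_lt hc')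

lemma inv_max_nonneg (r s : ℝ) : 0 ≤ (max (max 1 r)⁻¹ s)⁻¹ :=
  inv_nonneg.2 (le_max_of_le_left (inv_nonneg.2 (le_max_of_le_left zero_le_one)))

/-- The sum comes from bounding the largest slope, so that there is no factor `K` in front: it is
important for the leading constant of the energy. -/
lemma norm_grad_logBubble_sq_le (ht : ∀ k, 0 ≤ t k) (hs : ∑ k, t k = 1) (hr : 0 ≤ r) (z : M) :
    ‖grad (logBubble r t x) z‖ ^ 2 ≤ ∑ k, 16 * (max (max 1 r)⁻¹ (dist z (x k)))⁻¹ ^ 2 := by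
  have h0 : 0 ≤ ∑ k, 16 * (max (max 1 r)⁻¹ (dist z (x k)))⁻¹ ^ 2 :=
    Finset.sum_nonneg fun k _ => by positivity
  have h := norm_grad_logBubble_le (r := r) (x := x) (z := z) ht hs
    (Real.sqrt_nonneg (∑ k, 16 * (max (max 1 r)⁻¹ (dist z (x k)))⁻¹ ^ 2)) fun k => by
      refine (slope_profile_le_inv_max r _ hr).trans (Real.le_sqrt_of_sq_le ?_)
      refine le_trans (le_of_eq (by ring)) (Finset.single_le_sum
        (f := fun k => 16 * (max (max 1 r)⁻¹ (dist z (x k)))⁻¹ ^ 2)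
        (fun k _ => by positivity) (Finset.mem_univ k))
  calc _ ≤ Real.sqrt (∑ k, 16 * (max (max 1 r)⁻¹ (dist z (x k)))⁻¹ ^ 2) ^ 2 :=
        pow_le_pow_left₀ (norm_nonneg _) h 2
    _ = _ := Real.sq_sqrt h0

lemma norm_grad_logBubble_le_sum (ht : ∀ k, 0 ≤ t k) (hs : ∑ k, t k = 1) (hr : 0 ≤ r) (z : M) :
    ‖grad (logBubble r t x) z‖ ≤ ∑ k, 4 * (max (max 1 r)⁻¹ (dist z (x k)))⁻¹ := by
  have hn : ∀ k, 0 ≤ 4 * (max (max 1 r)⁻¹ (dist z (x k)))⁻¹ := fun k =>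
    mul_nonneg zero_le_four (inv_max_nonneg _ _)
  refine norm_grad_logBubble_le ht hs (Finset.sum_nonneg fun k _ => hn k) fun k => ?_
  exact (slope_profile_le_inv_max r _ hr).trans (Finset.single_le_sum
    (f := fun k => 4 * (max (max 1 r)⁻¹ (dist z (x k)))⁻¹) (fun k _ => hn k) (Finset.mem_univ k))

lemma norm_grad_logBubble_le_of_le_dist (ht : ∀ k, 0 ≤ t k) (hs : ∑ k, t k = 1) (hr : 0 ≤ r)
    {z : M} {δ : ℝ} (hδ : 0 < δ) (hz : ∀ k, δ ≤ dist z (x k)) :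
    ‖grad (logBubble r t x) z‖ ≤ 4 * δ⁻¹ := by
  refine norm_grad_logBubble_le ht hs (by positivity) fun k => ?_
  refine (slope_profile_le_inv_max r _ hr).trans ?_
  have := inv_anti₀ hδ ((hz k).trans (le_max_right (max 1 r)⁻¹ _))
  linarith

end Slope

/-- The product of the gradients of two bubbles with distant centres is controlled by the inverse
distances to the centres, because one of the two gradients is bounded at every point. -/
lemma norm_grad_mul_norm_grad_le {K K' : ℕ} {r r' : ℝ} {t : Fin K → ℝ} {x : Fin K → M}
    {t' : Fin K' → ℝ} {x' : Fin K' → M} (ht : ∀ k, 0 ≤ t k) (hs : ∑ k, t k = 1) (hr : 0 ≤ r)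
    (ht' : ∀ k, 0 ≤ t' k) (hs' : ∑ k, t' k = 1) (hr' : 0 ≤ r') {δ : ℝ} (hδ : 0 < δ)
    (hx : ∀ k j, 2 * δ ≤ dist (x k) (x' j)) (z : M) :
    ‖grad (logBubble r t x) z‖ * ‖grad (logBubble r' t' x') z‖ ≤
      4 * δ⁻¹ * (∑ k, 4 * (max (max 1 r)⁻¹ (dist z (x k)))⁻¹ +
        ∑ k, 4 * (max (max 1 r')⁻¹ (dist z (x' k)))⁻¹) := by
  have h1 := norm_grad_logBubble_le_sum (x := x) ht hs hr z
  have h2 := norm_grad_logBubble_le_sum (x := x') ht' hs' hr' z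
  have n1 := norm_nonneg (grad (logBubble r t x) z)
  have n2 := norm_nonneg (grad (logBubble r' t' x') z)
  have hδ' : 0 < 4 * δ⁻¹ := by positivity
  by_cases h : ∀ k, δ ≤ dist z (x k)
  · have h3 := norm_grad_logBubble_le_of_le_dist ht hs hr hδ h
    calc _ ≤ 4 * δ⁻¹ * ∑ k, 4 * (max (max 1 r')⁻¹ (dist z (x' k)))⁻¹ :=
          mul_le_mul h3 h2 n2 hδ'.le
      _ ≤ _ := mul_le_mul_of_nonneg_left (by linarith) hδ'.le
  · push Not at h
    obtain ⟨k, hk⟩ := h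
    have h3 := norm_grad_logBubble_le_of_le_dist (r := r') (x := x') (z := z) ht' hs' hr' hδ
      fun j => by
        have := dist_triangle_left (x k) (x' j) z
        linarith [hx k j]
    rw [mul_comm]
    calc _ ≤ 4 * δ⁻¹ * ∑ k, 4 * (max (max 1 r)⁻¹ (dist z (x k)))⁻¹ := mul_le_mul h3 h1 n1 hδ'.le
      _ ≤ _ := mul_le_mul_of_nonneg_left (by linarith) hδ'.le

variable [MeasurableSpace M] [BorelSpace M] [CompactSpace M]

lemma ae_weakGradient_sub_const_mul {f g : M → ℝ} {C D : ℝ≥0} (hf : LipschitzWith C f)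
    (hg : LipschitzWith D g) (c : ℝ) :
    ∀ᵐ z ∂(area M), weakGradient (fun z => f z - c * g z) z = grad f z - c • grad g z := by
  obtain ⟨E, hE⟩ := exists_lipschitzWith_sub_const_mul hf hg c
  filter_upwards [weakGradient_ae_eq_grad hE, ae_mdifferentiableAt hf, ae_mdifferentiableAt hg]
    with z h1 h2 h3
  rw [h1, grad_sub_const_mul h2 h3]

/-- The energy density of `B₂` on the test functions, in terms of the two bubbles. -/
lemma ae_QB2_eq {f g : M → ℝ} {C D : ℝ≥0} (hf : LipschitzWith C f) (hg : LipschitzWith D g) :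
    ∀ᵐ z ∂(area M), QB2 (fun z => f z - g z / 2, fun z => g z - f z) z =
      ‖grad f z‖ ^ 2 / 4 - inner ℝ (grad f z) (grad g z) / 4 + ‖grad g z‖ ^ 2 / 8 := by
  have e1 : (fun z => f z - g z / 2) = fun z => f z - 1 / 2 * g z := by ext z; ring
  have e2 : (fun z => g z - f z) = fun z => g z - 1 * f z := by ext z; ring
  filter_upwards [ae_weakGradient_sub_const_mul hf hg (1 / 2),
    ae_weakGradient_sub_const_mul hg hf 1] with z h1 h2
  rw [QB2, e1, e2, h1, h2, norm_sub_sq_real, norm_sub_sq_real]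
  simp only [inner_sub_left, inner_sub_right, real_inner_smul_left, real_inner_smul_right,
    real_inner_self_eq_norm_sq, norm_smul, Real.norm_eq_abs, mul_pow, sq_abs,
    real_inner_comm (grad f z) (grad g z)]
  ring

/-- The energy density of `G₂` on the test functions, in terms of the two bubbles. -/
lemma ae_QG2_eq {f g : M → ℝ} {C D : ℝ≥0} (hf : LipschitzWith C f) (hg : LipschitzWith D g) :
    ∀ᵐ z ∂(area M), QG2 (fun z => f z - g z / 2, fun z => g z - 3 / 2 * f z) z =
      ‖grad f z‖ ^ 2 / 4 - inner ℝ (grad f z) (grad g z) / 4 + ‖grad g z‖ ^ 2 / 12 := by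
  have e1 : (fun z => f z - g z / 2) = fun z => f z - 1 / 2 * g z := by ext z; ring
  filter_upwards [ae_weakGradient_sub_const_mul hf hg (1 / 2),
    ae_weakGradient_sub_const_mul hg hf (3 / 2)] with z h1 h2
  rw [QG2, e1, h1, h2, norm_sub_sq_real, norm_sub_sq_real]
  simp only [inner_sub_left, inner_sub_right, real_inner_smul_left, real_inner_smul_right,
    real_inner_self_eq_norm_sq, norm_smul, Real.norm_eq_abs, mul_pow, sq_abs,
    real_inner_comm (grad f z) (grad g z)]
  ring

end Gradients

/-- Discs of radius `s < r₀` have measure between `a s²` and `A s²`. -/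
structure HasDiscBounds {M : Type*} [MetricSpace M] [MeasurableSpace M] (μ : Measure M)
    (A a r₀ : ℝ) : Prop where
  A_nonneg : 0 ≤ A
  a_pos : 0 < a
  r₀_pos : 0 < r₀
  r₀_le_one : r₀ ≤ 1
  upper : ∀ (x : M) (s : ℝ), 0 < s → s < r₀ → μ (Metric.ball x s) ≤ ENNReal.ofReal (A * s ^ 2)
  lower : ∀ (x : M) (s : ℝ), 0 < s → s < r₀ → ENNReal.ofReal (a * s ^ 2) ≤ μ (Metric.ball x s)

section Estimates

variable {M : Type*} [MetricSpace M] [ChartedSpace Plane M] [IsManifold (𝓡 2) ∞ M]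
  [RiemannianBundle (fun x : M => TangentSpace (𝓡 2) x)]
  [IsContMDiffRiemannianBundle (𝓡 2) ∞ Plane (fun x : M => TangentSpace (𝓡 2) x)]
  [IsRiemannianManifold (𝓡 2) M] [MeasurableSpace M] [BorelSpace M] [CompactSpace M]
  [IsProbabilityMeasure (area M)] {A a r₀ : ℝ}

/-- The energy of two bubbles with distant centres: any density `Q` which lies between `0` and
`|∇φ|²/4 + β|∇ψ|² + |∇φ||∇ψ|/4` has integral at most `8 K A log L + 32 β K' A log L'`, up to a
constant. -/
lemma exists_integral_le_of_le_grad (hb : HasDiscBounds (area M) A a r₀) {δ : ℝ} (hδ : 0 < δ)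
    {β : ℝ} (hβ : 0 ≤ β) (K K' : ℕ) :
    ∃ E : ℝ, ∀ (r r' : ℝ) (t : Fin K → ℝ) (x : Fin K → M) (t' : Fin K' → ℝ) (x' : Fin K' → M),
      0 ≤ r → 0 ≤ r' → (∀ k, 0 ≤ t k) → ∑ k, t k = 1 → (∀ k, 0 ≤ t' k) → ∑ k, t' k = 1 →
      (∀ k j, 2 * δ ≤ dist (x k) (x' j)) → ∀ Q : M → ℝ,
      (∀ᵐ z ∂(area M), 0 ≤ Q z ∧ Q z ≤ ‖grad (logBubble r t x) z‖ ^ 2 / 4 +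
        β * ‖grad (logBubble r' t' x') z‖ ^ 2 +
        ‖grad (logBubble r t x) z‖ * ‖grad (logBubble r' t' x') z‖ / 4) →
      ∫ z, Q z ∂(area M) ≤ 8 * K * A * Real.log (max 1 r) +
        32 * β * K' * A * Real.log (max 1 r') + E := by
  set s₀ := (r₀ ^ 2)⁻¹
  set e := r₀⁻¹ + A * r₀
  refine ⟨4 * K * s₀ + 16 * β * K' * s₀ + δ⁻¹ * (4 * K * e + 4 * K' * e), ?_⟩
  intro r r' t x t' x' hr hr' ht hs ht' hs' hx Q hQ
  have hsq : ∀ (r : ℝ) (y : M),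
      Integrable (fun z => (max (max 1 r)⁻¹ (dist z y))⁻¹ ^ 2) (area M) ∧
      ∫ z, (max (max 1 r)⁻¹ (dist z y))⁻¹ ^ 2 ∂(area M) ≤
        s₀ + 2 * A * Real.log (max 1 r) := fun r y =>
    integral_inv_max_dist_sq_le hb.A_nonneg hb.r₀_pos hb.r₀_le_one (hb.upper y) (le_max_left _ _)
  have hlin : ∀ (r : ℝ) (y : M), Integrable (fun z => (max (max 1 r)⁻¹ (dist z y))⁻¹) (area M) ∧
      ∫ z, (max (max 1 r)⁻¹ (dist z y))⁻¹ ∂(area M) ≤ e := fun r y =>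
    integral_inv_max_dist_le hb.A_nonneg hb.r₀_pos (hb.upper y)
      (inv_pos.2 (lt_max_of_lt_left one_pos))
  have hsum2 : ∀ (K : ℕ) (r : ℝ) (x : Fin K → M),
      Integrable (fun z => ∑ k, 16 * (max (max 1 r)⁻¹ (dist z (x k)))⁻¹ ^ 2) (area M) ∧
      ∫ z, ∑ k, 16 * (max (max 1 r)⁻¹ (dist z (x k)))⁻¹ ^ 2 ∂(area M) ≤
        K * (16 * (s₀ + 2 * A * Real.log (max 1 r))) := by
    intro K r x
    refine ⟨integrable_finsetSum _ fun k _ => (hsq r (x k)).1.const_mul 16, ?_⟩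
    rw [integral_finsetSum _ fun k _ => (hsq r (x k)).1.const_mul 16]
    refine (Finset.sum_le_card_nsmul _ _ _ fun k _ => ?_).trans_eq
      (by rw [Finset.card_univ, Fintype.card_fin, nsmul_eq_mul])
    rw [integral_const_mul]
    exact mul_le_mul_of_nonneg_left (hsq r (x k)).2 (by norm_num)
  have hsum1 : ∀ (K : ℕ) (r : ℝ) (x : Fin K → M),
      Integrable (fun z => ∑ k, 4 * (max (max 1 r)⁻¹ (dist z (x k)))⁻¹) (area M) ∧
      ∫ z, ∑ k, 4 * (max (max 1 r)⁻¹ (dist z (x k)))⁻¹ ∂(area M) ≤ K * (4 * e) := by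
    intro K r x
    refine ⟨integrable_finsetSum _ fun k _ => (hlin r (x k)).1.const_mul 4, ?_⟩
    rw [integral_finsetSum _ fun k _ => (hlin r (x k)).1.const_mul 4]
    refine (Finset.sum_le_card_nsmul _ _ _ fun k _ => ?_).trans_eq
      (by rw [Finset.card_univ, Fintype.card_fin, nsmul_eq_mul])
    rw [integral_const_mul]
    exact mul_le_mul_of_nonneg_left (hlin r (x k)).2 (by norm_num)
  obtain ⟨i1, b1⟩ := hsum2 K r x
  obtain ⟨i2, b2⟩ := hsum2 K' r' x'
  obtain ⟨i3, b3⟩ := hsum1 K r x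
  obtain ⟨i4, b4⟩ := hsum1 K' r' x'
  set F₁ := fun z => ∑ k, 16 * (max (max 1 r)⁻¹ (dist z (x k)))⁻¹ ^ 2 with hF₁
  set F₂ := fun z => ∑ k, 16 * (max (max 1 r')⁻¹ (dist z (x' k)))⁻¹ ^ 2 with hF₂
  set F₃ := fun z => ∑ k, 4 * (max (max 1 r)⁻¹ (dist z (x k)))⁻¹ with hF₃
  set F₄ := fun z => ∑ k, 4 * (max (max 1 r')⁻¹ (dist z (x' k)))⁻¹ with hF₄
  have hle : Q ≤ᵐ[area M] fun z => (1 / 4 * F₁ z + β * F₂ z) + δ⁻¹ * (F₃ z + F₄ z) := by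
    filter_upwards [hQ] with z hz
    have h1 := norm_grad_logBubble_sq_le (x := x) ht hs hr z
    have h2 := mul_le_mul_of_nonneg_left
      (norm_grad_logBubble_sq_le (x := x') ht' hs' hr' z) hβ
    have h3 := norm_grad_mul_norm_grad_le ht hs hr ht' hs' hr' hδ hx z
    have h4 := hz.2
    simp only [hF₁, hF₂, hF₃, hF₄]
    linarith
  have j1 : Integrable (fun z => 1 / 4 * F₁ z) (area M) := i1.const_mul _
  have j2 : Integrable (fun z => β * F₂ z) (area M) := i2.const_mul _
  have j12 : Integrable (fun z => 1 / 4 * F₁ z + β * F₂ z) (area M) := j1.add j2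
  have j34 : Integrable (fun z => δ⁻¹ * (F₃ z + F₄ z)) (area M) := (i3.add i4).const_mul _
  have j : Integrable (fun z => 1 / 4 * F₁ z + β * F₂ z + δ⁻¹ * (F₃ z + F₄ z)) (area M) :=
    j12.add j34
  refine (integral_mono_of_nonneg (hQ.mono fun z hz => hz.1) j hle).trans ?_
  rw [integral_add j12 j34, integral_add j1 j2, integral_const_mul, integral_const_mul,
    integral_const_mul, integral_add i3 i4]
  have hδ' : 0 < δ⁻¹ := inv_pos.2 hδ
  have c2 := mul_le_mul_of_nonneg_left b2 hβ
  have c3 := mul_le_mul_of_nonneg_left (add_le_add b3 b4) hδ'.le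
  have c1 := mul_le_mul_of_nonneg_left b1 (show (0 : ℝ) ≤ 1 / 4 by norm_num)
  refine (add_le_add (add_le_add c1 c2) c3).trans_eq ?_
  ring

lemma integrable_of_continuous {f : M → ℝ} (hf : Continuous f) : Integrable f (area M) :=
  hf.integrable_of_hasCompactSupport (HasCompactSupport.of_compactSpace f)

/-- The mean of a bubble is at most `-4 log L`, up to a constant. -/
lemma integral_logBubble_le (hb : HasDiscBounds (area M) A a r₀) {K : ℕ} {r : ℝ} {t : Fin K → ℝ}
    {x : Fin K → M} (ht : ∀ k, 0 ≤ t k) (hs : ∑ k, t k = 1) (hr : 0 ≤ r) :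
    ∫ z, logBubble r t x z ∂(area M) ≤ -4 * Real.log (max 1 r) + K * (4 * (r₀⁻¹ + A * r₀)) := by
  have hlin : ∀ y : M, Integrable (fun z => (max (max 1 r)⁻¹ (dist z y))⁻¹) (area M) ∧
      ∫ z, (max (max 1 r)⁻¹ (dist z y))⁻¹ ∂(area M) ≤ r₀⁻¹ + A * r₀ := fun y =>
    integral_inv_max_dist_le hb.A_nonneg hb.r₀_pos (hb.upper y)
      (inv_pos.2 (lt_max_of_lt_left one_pos))
  have hi : Integrable (fun z => ∑ k, 4 * (max (max 1 r)⁻¹ (dist z (x k)))⁻¹) (area M) :=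
    integrable_finsetSum _ fun k _ => (hlin (x k)).1.const_mul 4
  calc ∫ z, logBubble r t x z ∂(area M)
      ≤ ∫ z, (-4 * Real.log (max 1 r) +
          ∑ k, 4 * (max (max 1 r)⁻¹ (dist z (x k)))⁻¹) ∂(area M) := by
        refine integral_mono (integrable_of_continuous
          (lipschitzWith_logBubble ht hs hr).continuous) ((integrable_const _).add hi) fun z => ?_
        refine logBubble_le_of_forall ht hs fun k => (profile_le_inv_max _ _).trans ?_
        gcongr
        exact Finset.single_le_sum
          (f := fun k => 4 * (max (max 1 r)⁻¹ (dist z (x k)))⁻¹)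
          (fun k _ => mul_nonneg zero_le_four (inv_max_nonneg _ _)) (Finset.mem_univ k)
    _ = -4 * Real.log (max 1 r) +
          ∑ k, 4 * ∫ z, (max (max 1 r)⁻¹ (dist z (x k)))⁻¹ ∂(area M) := by
        rw [integral_add (integrable_const _) hi,
          integral_finsetSum _ fun k _ => (hlin (x k)).1.const_mul 4]
        simp [integral_const_mul]
    _ ≤ _ := by
        gcongr
        refine (Finset.sum_le_card_nsmul _ _ (4 * (r₀⁻¹ + A * r₀)) fun k _ => ?_).trans_eq
          (by rw [Finset.card_univ, Fintype.card_fin, nsmul_eq_mul])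
        exact mul_le_mul_of_nonneg_left (hlin (x k)).2 zero_le_four

/-- The logarithmic term of `φ - βψ`, for bubbles `φ` and `ψ` with distant centres, is at least
`2 log L`, up to a constant: near a centre of `φ` with weight at least `1/K`, `e^φ` is bounded below
on a disc of radius of order `1/L`, while `ψ` is there as small as its mean. -/
lemma exists_le_logTerm (hb : HasDiscBounds (area M) A a r₀) {δ : ℝ} (hδ : 0 < δ) (hδ1 : δ ≤ 1)
    {β : ℝ} (hβ : 0 ≤ β) (K K' : ℕ) {h : M → ℝ} (hc : Continuous h) (hpos : ∀ z, 0 < h z) :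
    ∃ E : ℝ, ∀ (r r' : ℝ) (t : Fin K → ℝ) (x : Fin K → M) (t' : Fin K' → ℝ) (x' : Fin K' → M),
      0 ≤ r → 0 ≤ r' → (∀ k, 0 ≤ t k) → ∑ k, t k = 1 → (∀ k, 0 ≤ t' k) → ∑ k, t' k = 1 →
      (∀ k j, 2 * δ ≤ dist (x k) (x' j)) →
      2 * Real.log (max 1 r) - E ≤
        logTerm h (fun z => logBubble r t x z - β * logBubble r' t' x' z) := by
  obtain ⟨z₀⟩ : Nonempty M := by
    by_contra hM
    rw [not_nonempty_iff] at hM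
    have h1 := measure_univ (μ := area M)
    rw [univ_eq_empty_iff.2 hM, measure_empty] at h1
    exact zero_ne_one h1
  obtain ⟨z₁, -, hz₁⟩ := isCompact_univ.exists_isMinOn ⟨z₀, mem_univ z₀⟩ hc.continuousOn
  set D := Metric.diam (univ : Set M)
  have hD : ∀ z z' : M, dist z z' ≤ D := fun z z' =>
    Metric.dist_le_diam_of_mem isCompact_univ.isBounded (mem_univ _) (mem_univ _)
  set c := min δ (r₀ / 2) with hcdef
  have hr₀ := hb.r₀_pos
  have hc0 : 0 < c := lt_min hδ (by positivity)
  have hc1 : c ≤ 1 := (min_le_left _ _).trans hδ1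
  refine ⟨-(Real.log (h z₁) - Real.log (4 * K) + β * (4 * Real.log δ) + Real.log a +
    2 * Real.log c) + K * (4 * (r₀⁻¹ + A * r₀)) + β * (2 * Real.log (1 + D ^ 2)), ?_⟩
  intro r r' t x t' x' hr hr' ht hs ht' hs' hx
  set L := max 1 r with hL
  set L' := max 1 r' with hL'
  have hL1 : 1 ≤ L := le_max_left _ _
  have hL0 : 0 < L := by linarith
  set φ := logBubble r t x with hφ
  set ψ := logBubble r' t' x' with hψ
  have hφc : Continuous φ := (lipschitzWith_logBubble ht hs hr).continuous
  have hψc : Continuous ψ := (lipschitzWith_logBubble ht' hs' hr').continuous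
  have hK : 0 < K := by
    rcases Nat.eq_zero_or_pos K with rfl | h
    · simp at hs
    · exact h
  have hK0 : (0 : ℝ) < K := by exact_mod_cast hK
  obtain ⟨k, hk⟩ : ∃ k, 1 / (K : ℝ) ≤ t k := by
    by_contra! hlt
    have h1 : ∑ k, t k < ∑ _k : Fin K, 1 / (K : ℝ) :=
      Finset.sum_lt_sum_of_nonempty ⟨⟨0, hK⟩, Finset.mem_univ _⟩ fun k _ => hlt k
    rw [hs, Finset.sum_const, Finset.card_univ, Fintype.card_fin, nsmul_eq_mul,
      mul_one_div_cancel hK0.ne'] at h1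
    exact lt_irrefl _ h1
  set s := c / L with hsdef
  have hs0 : 0 < s := by positivity
  have hsc : s ≤ c := div_le_self hc0.le hL1
  set q := h z₁ * (1 / (4 * K)) * Real.exp (β * (4 * Real.log L' + 4 * Real.log δ)) with hq
  have hq0 : 0 < q := by
    have := hpos z₁
    positivity
  have hpt : ∀ z ∈ Metric.ball (x k) s, q ≤ h z * Real.exp (φ z - β * ψ z) := by
    intro z hz
    rw [Metric.mem_ball] at hz
    have h1 : 1 / (4 * (K : ℝ)) ≤ Real.exp (φ z) := by
      rw [hφ, logBubble, Real.exp_log (sum_profile_pos ht hs z)]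
      have hrd : r * dist z (x k) ≤ 1 := by
        calc r * dist z (x k) ≤ L * s := mul_le_mul (le_max_right _ _) hz.le dist_nonneg hL0.le
          _ = c := by rw [hsdef]; field_simp
          _ ≤ 1 := hc1
      have h2 : (1 + (r * dist z (x k)) ^ 2) ^ 2 ≤ 4 := by
        have h3 : (r * dist z (x k)) ^ 2 ≤ 1 := pow_le_one₀ (by positivity) hrd
        nlinarith [sq_nonneg (r * dist z (x k))]
      calc 1 / (4 * (K : ℝ)) = 1 / K / 4 := by field_simp
        _ ≤ t k / (1 + (r * dist z (x k)) ^ 2) ^ 2 :=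
            div_le_div₀ (ht k) hk (by positivity) h2
        _ ≤ _ := Finset.single_le_sum
            (f := fun k => t k / (1 + (r * dist z (x k)) ^ 2) ^ 2)
            (fun k _ => div_nonneg (ht k) (by positivity)) (Finset.mem_univ k)
    have h2 : ψ z ≤ -4 * Real.log L' - 4 * Real.log δ := by
      refine logBubble_le_of_forall ht' hs' fun j => profile_le_of_le hr' hδ hδ1 ?_
      have h3 := dist_triangle_left (x k) (x' j) z
      have h4 : s ≤ δ := hsc.trans (min_le_left _ _)
      linarith [hx k j]
    have h3 : β * (4 * Real.log L' + 4 * Real.log δ) ≤ -(β * ψ z) := by nlinarith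
    rw [sub_eq_add_neg, Real.exp_add, ← mul_assoc, hq]
    have h4 := hpos z
    have h5 := hpos z₁
    have h6 : h z₁ ≤ h z := hz₁ (mem_univ z)
    gcongr
  have hfi : Integrable (fun z => h z * Real.exp (φ z - β * ψ z)) (area M) :=
    integrable_of_continuous (hc.mul (hφc.sub (continuous_const.mul hψc)).rexp)
  have hball : a * s ^ 2 ≤ (area M).real (Metric.ball (x k) s) := by
    have h1 := hb.lower (x k) s hs0 (by
      have h3 : c ≤ r₀ / 2 := min_le_right _ _
      linarith)
    rw [Measure.real, ← ENNReal.ofReal_le_iff_le_toReal (measure_ne_top _ _)]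
    exact h1
  have ha := hb.a_pos
  have hint : q * (a * s ^ 2) ≤ ∫ z, h z * Real.exp (φ z - β * ψ z) ∂(area M) := by
    calc q * (a * s ^ 2) ≤ q * (area M).real (Metric.ball (x k) s) :=
          mul_le_mul_of_nonneg_left hball hq0.le
      _ = ∫ z in Metric.ball (x k) s, q ∂(area M) := by
          rw [setIntegral_const, smul_eq_mul, mul_comm]
      _ ≤ ∫ z in Metric.ball (x k) s, h z * Real.exp (φ z - β * ψ z) ∂(area M) :=
          setIntegral_mono_on (integrable_const _).integrableOn hfi.integrableOn
            Metric.isOpen_ball.measurableSet hpt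
      _ ≤ _ := setIntegral_le_integral hfi (ae_of_all _ fun z =>
          mul_nonneg (hpos z).le (Real.exp_pos _).le)
  have hlog : Real.log (h z₁) - Real.log (4 * K) + β * (4 * Real.log L' + 4 * Real.log δ) +
      Real.log a + 2 * Real.log c - 2 * Real.log L ≤
      Real.log (∫ z, h z * Real.exp (φ z - β * ψ z) ∂(area M)) := by
    refine le_trans (le_of_eq ?_) (Real.log_le_log (by positivity) hint)
    have h5 := (hpos z₁).ne'
    have e1 : Real.log q = Real.log (h z₁) - Real.log (4 * K) +
        β * (4 * Real.log L' + 4 * Real.log δ) := by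
      rw [hq, Real.log_mul (mul_ne_zero h5 (by positivity)) (Real.exp_pos _).ne',
        Real.log_mul h5 (by positivity), Real.log_exp, one_div, Real.log_inv]
      ring
    have e2 : Real.log (a * s ^ 2) = Real.log a + 2 * Real.log c - 2 * Real.log L := by
      rw [Real.log_mul ha.ne' (by positivity), Real.log_pow, hsdef,
        Real.log_div hc0.ne' hL0.ne']
      push_cast
      ring
    rw [Real.log_mul hq0.ne' (by positivity), e1, e2]
    ring
  have hφi := integral_logBubble_le hb (x := x) ht hs hr
  have hψi : -4 * Real.log L' - 2 * Real.log (1 + D ^ 2) ≤ ∫ z, ψ z ∂(area M) := by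
    calc -4 * Real.log L' - 2 * Real.log (1 + D ^ 2)
        = ∫ _z, (-4 * Real.log L' - 2 * Real.log (1 + D ^ 2)) ∂(area M) := by simp
      _ ≤ _ := integral_mono (integrable_const _) (integrable_of_continuous hψc) fun z =>
          le_logBubble_of_forall ht' hs' fun j => le_profile hr' dist_nonneg (hD _ _)
  have hψi' := mul_le_mul_of_nonneg_left hψi hβ
  rw [logTerm, integral_sub (integrable_of_continuous hφc)
    ((integrable_of_continuous hψc).const_mul β), integral_const_mul]
  linarith

end Estimates

/-! ### Upper bounds for the two functionals -/

section Functionals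

variable {M : Type*} [MetricSpace M] [ChartedSpace Plane M] [IsManifold (𝓡 2) ∞ M]
  [RiemannianBundle (fun x : M => TangentSpace (𝓡 2) x)]
  [IsContMDiffRiemannianBundle (𝓡 2) ∞ Plane (fun x : M => TangentSpace (𝓡 2) x)]
  [IsRiemannianManifold (𝓡 2) M] [MeasurableSpace M] [BorelSpace M] [CompactSpace M]

lemma exists_hasDiscBounds {κ : ℝ} (hκ : 1 < κ) :
    ∃ a r₀, HasDiscBounds (area M) (κ ^ 3 * Real.pi) a r₀ := by
  obtain ⟨r, hr, h⟩ := exists_radius_area_ball_bounds (M := M) hκ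
  have hπ := Real.pi_pos
  exact ⟨(κ ^ 3)⁻¹ * Real.pi, min r 1, by positivity, by positivity, lt_min hr one_pos,
    min_le_right _ _, fun x s hs hsr => (h s hs (hsr.trans_le (min_le_left _ _)) x).1,
    fun x s hs hsr => (h s hs (hsr.trans_le (min_le_left _ _)) x).2⟩

variable [IsProbabilityMeasure (area M)] {A a r₀ : ℝ}

/-- Upper bound for the functional of `B₂`: the energy contributes `8 K A` and `4 K' A` to the
coefficients of the logarithms, the logarithmic terms `-2 ρ₁` and `-ρ₂`. -/
lemma exists_JB2_le (hb : HasDiscBounds (area M) A a r₀) {δ : ℝ} (hδ : 0 < δ) (hδ1 : δ ≤ 1)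
    (K K' : ℕ) {h₁ h₂ : M → ℝ} (hc₁ : Continuous h₁) (hc₂ : Continuous h₂)
    (hpos₁ : ∀ z, 0 < h₁ z) (hpos₂ : ∀ z, 0 < h₂ z) {ρ₁ ρ₂ : ℝ} (hρ₁ : 0 ≤ ρ₁) (hρ₂ : 0 ≤ ρ₂) :
    ∃ E : ℝ, ∀ (r r' : ℝ) (t : Fin K → ℝ) (x : Fin K → M) (t' : Fin K' → ℝ) (x' : Fin K' → M),
      0 ≤ r → 0 ≤ r' → (∀ k, 0 ≤ t k) → ∑ k, t k = 1 → (∀ k, 0 ≤ t' k) → ∑ k, t' k = 1 →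
      (∀ k j, 2 * δ ≤ dist (x k) (x' j)) →
      JB2 (h₁, h₂) (ρ₁, ρ₂) (fun z => logBubble r t x z - logBubble r' t' x' z / 2,
        fun z => logBubble r' t' x' z - logBubble r t x z) ≤
      2 * (4 * K * A - ρ₁) * Real.log (max 1 r) + (4 * K' * A - ρ₂) * Real.log (max 1 r') + E := by
  obtain ⟨E, hE⟩ := exists_integral_le_of_le_grad hb hδ (β := 1 / 8) (by norm_num) K K'
  obtain ⟨E₁, hE₁⟩ := exists_le_logTerm hb hδ hδ1 (β := 1 / 2) (by norm_num) K K' hc₁ hpos₁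
  obtain ⟨E₂, hE₂⟩ := exists_le_logTerm hb hδ hδ1 (β := 1) (by norm_num) K' K hc₂ hpos₂
  refine ⟨E + ρ₁ * E₁ + ρ₂ / 2 * E₂, ?_⟩
  intro r r' t x t' x' hr hr' ht hs ht' hs' hx
  have hφ := lipschitzWith_logBubble (x := x) ht hs hr
  have hψ := lipschitzWith_logBubble (x := x') ht' hs' hr'
  have e0 := hE r r' t x t' x' hr hr' ht hs ht' hs' hx (QB2
    (fun z => logBubble r t x z - logBubble r' t' x' z / 2,
      fun z => logBubble r' t' x' z - logBubble r t x z)) (by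
    filter_upwards [ae_QB2_eq hφ hψ] with z hz
    have h1 := abs_le.1 (abs_real_inner_le_norm (grad (logBubble r t x) z)
      (grad (logBubble r' t' x') z))
    rw [hz]
    constructor
    · nlinarith [sq_nonneg (‖grad (logBubble r t x) z‖ - ‖grad (logBubble r' t' x') z‖),
        sq_nonneg ‖grad (logBubble r t x) z‖]
    · linarith)
  have e1 := mul_le_mul_of_nonneg_left (hE₁ r r' t x t' x' hr hr' ht hs ht' hs' hx) hρ₁
  have e2 := mul_le_mul_of_nonneg_left (hE₂ r' r t' x' t x hr' hr ht' hs' ht hs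
    fun k j => by rw [dist_comm]; exact hx j k) (show 0 ≤ ρ₂ / 2 by positivity)
  have u1 : (fun z => logBubble r t x z - logBubble r' t' x' z / 2) =
      fun z => logBubble r t x z - 1 / 2 * logBubble r' t' x' z := by ext z; ring
  have u2 : (fun z => logBubble r' t' x' z - logBubble r t x z) =
      fun z => logBubble r' t' x' z - 1 * logBubble r t x z := by ext z; ring
  rw [← u1] at e1
  rw [← u2] at e2
  rw [JB2]
  dsimp only
  linarith

/-- Upper bound for the functional of `G₂`: the energy contributes `8 K A` and `8 K' A / 3` to the
coefficients of the logarithms, the logarithmic terms `-2 ρ₁` and `-2 ρ₂ / 3`. -/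
lemma exists_JG2_le (hb : HasDiscBounds (area M) A a r₀) {δ : ℝ} (hδ : 0 < δ) (hδ1 : δ ≤ 1)
    (K K' : ℕ) {h₁ h₂ : M → ℝ} (hc₁ : Continuous h₁) (hc₂ : Continuous h₂)
    (hpos₁ : ∀ z, 0 < h₁ z) (hpos₂ : ∀ z, 0 < h₂ z) {ρ₁ ρ₂ : ℝ} (hρ₁ : 0 ≤ ρ₁) (hρ₂ : 0 ≤ ρ₂) :
    ∃ E : ℝ, ∀ (r r' : ℝ) (t : Fin K → ℝ) (x : Fin K → M) (t' : Fin K' → ℝ) (x' : Fin K' → M),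
      0 ≤ r → 0 ≤ r' → (∀ k, 0 ≤ t k) → ∑ k, t k = 1 → (∀ k, 0 ≤ t' k) → ∑ k, t' k = 1 →
      (∀ k j, 2 * δ ≤ dist (x k) (x' j)) →
      JG2 (h₁, h₂) (ρ₁, ρ₂) (fun z => logBubble r t x z - logBubble r' t' x' z / 2,
        fun z => logBubble r' t' x' z - 3 / 2 * logBubble r t x z) ≤
      2 * (4 * K * A - ρ₁) * Real.log (max 1 r) +
        2 / 3 * (4 * K' * A - ρ₂) * Real.log (max 1 r') + E := by
  obtain ⟨E, hE⟩ := exists_integral_le_of_le_grad hb hδ (β := 1 / 12) (by norm_num) K K'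
  obtain ⟨E₁, hE₁⟩ := exists_le_logTerm hb hδ hδ1 (β := 1 / 2) (by norm_num) K K' hc₁ hpos₁
  obtain ⟨E₂, hE₂⟩ := exists_le_logTerm hb hδ hδ1 (β := 3 / 2) (by norm_num) K' K hc₂ hpos₂
  refine ⟨E + ρ₁ * E₁ + ρ₂ / 3 * E₂, ?_⟩
  intro r r' t x t' x' hr hr' ht hs ht' hs' hx
  have hφ := lipschitzWith_logBubble (x := x) ht hs hr
  have hψ := lipschitzWith_logBubble (x := x') ht' hs' hr'
  have e0 := hE r r' t x t' x' hr hr' ht hs ht' hs' hx (QG2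
    (fun z => logBubble r t x z - logBubble r' t' x' z / 2,
      fun z => logBubble r' t' x' z - 3 / 2 * logBubble r t x z)) (by
    filter_upwards [ae_QG2_eq hφ hψ] with z hz
    have h1 := abs_le.1 (abs_real_inner_le_norm (grad (logBubble r t x) z)
      (grad (logBubble r' t' x') z))
    rw [hz]
    constructor
    · nlinarith [sq_nonneg (3 / 2 * ‖grad (logBubble r t x) z‖ - ‖grad (logBubble r' t' x') z‖),
        sq_nonneg ‖grad (logBubble r t x) z‖]
    · linarith)
  have e1 := mul_le_mul_of_nonneg_left (hE₁ r r' t x t' x' hr hr' ht hs ht' hs' hx) hρ₁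
  have e2 := mul_le_mul_of_nonneg_left (hE₂ r' r t' x' t x hr' hr ht' hs' ht hs
    fun k j => by rw [dist_comm]; exact hx j k) (show 0 ≤ ρ₂ / 3 by positivity)
  have u1 : (fun z => logBubble r t x z - logBubble r' t' x' z / 2) =
      fun z => logBubble r t x z - 1 / 2 * logBubble r' t' x' z := by ext z; ring
  rw [← u1] at e1
  rw [JG2]
  dsimp only
  linarith

end Functionals

section Join

/-- A point of the join has a representative by weights and points for which both functions are
bubbles, for all `λ` at once. -/
lemma exists_phi_eq {M : Type*} [MetricSpace M] [MeasurableSpace M] [BorelSpace M]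
    {γ₁ γ₂ : Set M} {K₁ K₂ : ℕ} (ζ : Join (barycenters γ₁ K₁) (barycenters γ₂ K₂)) :
    ∃ (s : ℝ) (t : Fin K₁ → ℝ) (x : Fin K₁ → M) (t' : Fin K₂ → ℝ) (x' : Fin K₂ → M),
      s ∈ Icc (0 : ℝ) 1 ∧ (∀ k, 0 ≤ t k) ∧ ∑ k, t k = 1 ∧ (∀ k, 0 ≤ t' k) ∧ ∑ k, t' k = 1 ∧
      (∀ k, x k ∈ γ₁) ∧ (∀ k, x' k ∈ γ₂) ∧ ∀ lam : ℝ,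
        phi₁ lam ζ = logBubble (lam * (1 - s)) t x ∧ phi₂ lam ζ = logBubble (lam * s) t' x' := by
  induction ζ using Quot.ind with
  | mk q =>
    obtain ⟨⟨σ, t, x, ht, hx, hs, rfl⟩, ⟨σ', t', x', ht', hx', hs', rfl⟩, s⟩ := q
    exact ⟨s, t, x, t', x', s.2, ht, hs, ht', hs', hx, hx', fun lam =>
      ⟨funext fun z => bubble_sum_dirac _ t x ht z, funext fun z => bubble_sum_dirac _ t' x' ht' z⟩⟩

/-- On the join at least one of the two concentration parameters `λ(1 - s)` and `λs` is at least
`λ/2`. -/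
lemma eventually_mul_log_add_lt {c₁ c₂ : ℝ} (hc₁ : c₁ < 0) (hc₂ : c₂ < 0) (E L : ℝ) :
    ∀ᶠ lam : ℝ in atTop, ∀ s ∈ Icc (0 : ℝ) 1,
      c₁ * Real.log (max 1 (lam * (1 - s))) + c₂ * Real.log (max 1 (lam * s)) + E < L := by
  have h1 : Tendsto (fun lam : ℝ => Real.log (lam / 2)) atTop atTop :=
    Real.tendsto_log_atTop.comp (tendsto_id.atTop_div_const two_pos)
  have h2 := (h1.const_mul_atTop_of_neg (max_lt hc₁ hc₂)).eventually_lt_atBot (L - E)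
  filter_upwards [h2, eventually_gt_atTop 0] with lam h hlam s hs
  have p1 : 0 ≤ Real.log (max 1 (lam * (1 - s))) := Real.log_nonneg (le_max_left _ _)
  have p2 : 0 ≤ Real.log (max 1 (lam * s)) := Real.log_nonneg (le_max_left _ _)
  have q1 := mul_le_mul_of_nonneg_right (le_max_left c₁ c₂) p1
  have q2 := mul_le_mul_of_nonneg_right (le_max_right c₁ c₂) p2
  have hm := max_lt hc₁ hc₂
  have key : Real.log (lam / 2) ≤
      Real.log (max 1 (lam * (1 - s))) + Real.log (max 1 (lam * s)) := by
    rcases le_total s (1 / 2) with h3 | h3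
    · have : Real.log (lam / 2) ≤ Real.log (max 1 (lam * (1 - s))) :=
        Real.log_le_log (by positivity) (le_max_of_le_right (by nlinarith))
      linarith
    · have : Real.log (lam / 2) ≤ Real.log (max 1 (lam * s)) :=
        Real.log_le_log (by positivity) (le_max_of_le_right (by nlinarith))
      linarith
  nlinarith [mul_le_mul_of_nonpos_left key hm.le]

end Join

lemma exists_separation {M : Type*} [MetricSpace M] {γ₁ γ₂ : Set M} (hγ₁ : IsCompact γ₁)
    (hγ₂ : IsCompact γ₂) (hdisj : Disjoint γ₁ γ₂) :
    ∃ δ : ℝ, 0 < δ ∧ δ ≤ 1 ∧ ∀ x ∈ γ₁, ∀ y ∈ γ₂, 2 * δ ≤ dist x y := by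
  obtain ⟨ε, hε, h⟩ := hdisj.exists_thickenings hγ₁ hγ₂.isClosed
  refine ⟨min (ε / 2) 1, by positivity, min_le_right _ _, fun x hx y hy => ?_⟩
  have h1 : ε ≤ dist x y := by
    by_contra! hlt
    exact h.le_bot ⟨Metric.self_subset_thickening hε _ hx, Metric.mem_thickening_iff.2 ⟨y, hy, hlt⟩⟩
  linarith [min_le_left (ε / 2) 1]

lemma eventually_four_mul_cube_mul_pi_lt {K : ℕ} {ρ : ℝ} (h : 4 * (K : ℝ) * Real.pi < ρ) :
    ∀ᶠ κ : ℝ in 𝓝[>] 1, 4 * K * (κ ^ 3 * Real.pi) < ρ := by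
  have hc : Continuous fun κ : ℝ => 4 * K * (κ ^ 3 * Real.pi) := by fun_prop
  have h1 := hc.tendsto 1
  simp only [one_pow, one_mul] at h1
  exact (h1.mono_left nhdsWithin_le_nhds).eventually_lt_const h

end TodaSurface

end

theorem theorem3p1
    {M : Type*} [MetricSpace M] [CompactSpace M] [MeasurableSpace M] [BorelSpace M]
    [ChartedSpace TodaSurface.Plane M] [IsManifold (𝓡 2) ∞ M]
    [RiemannianBundle (fun x : M => TangentSpace (𝓡 2) x)]
    [IsContMDiffRiemannianBundle (𝓡 2) ∞ TodaSurface.Plane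
      (fun x : M => TangentSpace (𝓡 2) x)]
    [IsRiemannianManifold (𝓡 2) M]
    (harea : TodaSurface.area M univ = 1)
    (h₁ h₂ : M → ℝ) (hh₁ : ContMDiff (𝓡 2) 𝓘(ℝ) ∞ h₁) (hh₂ : ContMDiff (𝓡 2) 𝓘(ℝ) ∞ h₂)
    (hpos₁ : ∀ x, 0 < h₁ x) (hpos₂ : ∀ x, 0 < h₂ x)
    (γ₁ γ₂ : Set M) (hγ₁ : IsCompact γ₁) (hγ₂ : IsCompact γ₂) (hdisj : Disjoint γ₁ γ₂)
    (K₁ K₂ : ℕ) (ρ₁ ρ₂ : ℝ)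
    (hρ₁ : ρ₁ ∈ Ioo (4 * (K₁ : ℝ) * Real.pi) (4 * ((K₁ : ℝ) + 1) * Real.pi))
    (hρ₂ : ρ₂ ∈ Ioo (4 * (K₂ : ℝ) * Real.pi) (4 * ((K₂ : ℝ) + 1) * Real.pi)) :
    (∀ lam : ℝ, 0 < lam →
      ∀ ζ : TodaSurface.Join (TodaSurface.barycenters γ₁ K₁) (TodaSurface.barycenters γ₂ K₂),
        TodaSurface.MemH1 (TodaSurface.PhiB2 lam ζ).1 ∧
        TodaSurface.MemH1 (TodaSurface.PhiB2 lam ζ).2 ∧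
        TodaSurface.MemH1 (TodaSurface.PhiG2 lam ζ).1 ∧
        TodaSurface.MemH1 (TodaSurface.PhiG2 lam ζ).2) ∧
    (∀ L : ℝ, ∀ᶠ lam : ℝ in atTop,
      ∀ ζ : TodaSurface.Join (TodaSurface.barycenters γ₁ K₁) (TodaSurface.barycenters γ₂ K₂),
        TodaSurface.JB2 (h₁, h₂) (ρ₁, ρ₂) (TodaSurface.PhiB2 lam ζ) < L) ∧
    (∀ L : ℝ, ∀ᶠ lam : ℝ in atTop,
      ∀ ζ : TodaSurface.Join (TodaSurface.barycenters γ₁ K₁) (TodaSurface.barycenters γ₂ K₂),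
        TodaSurface.JG2 (h₁, h₂) (ρ₁, ρ₂) (TodaSurface.PhiG2 lam ζ) < L) := by
  have hprob : IsProbabilityMeasure (TodaSurface.area M) := ⟨harea⟩
  obtain ⟨δ, hδ, hδ1, hsep⟩ := TodaSurface.exists_separation hγ₁ hγ₂ hdisj
  -- The discs are compared with Euclidean ones closely enough to keep the coefficients of the
  -- logarithms negative.
  obtain ⟨κ, ⟨hκ₁, hκ₂⟩, hκ⟩ := (((TodaSurface.eventually_four_mul_cube_mul_pi_lt hρ₁.1).and
    (TodaSurface.eventually_four_mul_cube_mul_pi_lt hρ₂.1)).and eventually_mem_nhdsWithin).exists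
  obtain ⟨a, r₀, hb⟩ := TodaSurface.exists_hasDiscBounds (M := M) hκ
  have hπ := Real.pi_pos
  have hp₁ : 0 ≤ ρ₁ := (le_trans (by positivity) hρ₁.1.le)
  have hp₂ : 0 ≤ ρ₂ := (le_trans (by positivity) hρ₂.1.le)
  refine ⟨fun lam hlam ζ => ?_, fun L => ?_, fun L => ?_⟩
  · obtain ⟨s, t, x, t', x', hs, ht, hts, ht', hts', hx, hx', hphi⟩ := TodaSurface.exists_phi_eq ζ
    obtain ⟨e₁, e₂⟩ := hphi lam
    have hf := TodaSurface.lipschitzWith_logBubble (x := x) ht hts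
      (mul_nonneg hlam.le (sub_nonneg.2 hs.2))
    have hg := TodaSurface.lipschitzWith_logBubble (x := x') ht' hts' (mul_nonneg hlam.le hs.1)
    rw [← e₁] at hf
    rw [← e₂] at hg
    obtain ⟨C₁, h1⟩ := TodaSurface.exists_lipschitzWith_sub_const_mul hf hg (1 / 2)
    obtain ⟨C₂, h2⟩ := TodaSurface.exists_lipschitzWith_sub_const_mul hg hf 1
    obtain ⟨C₃, h3⟩ := TodaSurface.exists_lipschitzWith_sub_const_mul hg hf (3 / 2)
    have u1 : (TodaSurface.PhiB2 lam ζ).1 =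
        fun z => TodaSurface.phi₁ lam ζ z - 1 / 2 * TodaSurface.phi₂ lam ζ z := by
      ext z; simp only [TodaSurface.PhiB2]; ring
    have u2 : (TodaSurface.PhiB2 lam ζ).2 =
        fun z => TodaSurface.phi₂ lam ζ z - 1 * TodaSurface.phi₁ lam ζ z := by
      ext z; simp only [TodaSurface.PhiB2]; ring
    rw [← u1] at h1
    rw [← u2] at h2
    exact ⟨TodaSurface.memH1_of_lipschitzWith h1, TodaSurface.memH1_of_lipschitzWith h2,
      TodaSurface.memH1_of_lipschitzWith h1, TodaSurface.memH1_of_lipschitzWith h3⟩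
  · obtain ⟨E, hE⟩ := TodaSurface.exists_JB2_le hb hδ hδ1 K₁ K₂ hh₁.continuous hh₂.continuous
      hpos₁ hpos₂ hp₁ hp₂
    filter_upwards [TodaSurface.eventually_mul_log_add_lt
      (c₁ := 2 * (4 * K₁ * (κ ^ 3 * Real.pi) - ρ₁)) (c₂ := 4 * K₂ * (κ ^ 3 * Real.pi) - ρ₂)
      (by linarith) (by linarith) E L, eventually_gt_atTop 0] with lam hL hlam ζ
    obtain ⟨s, t, x, t', x', hs, ht, hts, ht', hts', hx, hx', hphi⟩ := TodaSurface.exists_phi_eq ζ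
    obtain ⟨e₁, e₂⟩ := hphi lam
    rw [TodaSurface.PhiB2, e₁, e₂]
    exact (hE _ _ t x t' x' (mul_nonneg hlam.le (sub_nonneg.2 hs.2)) (mul_nonneg hlam.le hs.1)
      ht hts ht' hts' fun k j => hsep _ (hx k) _ (hx' j)).trans_lt (hL s hs)
  · obtain ⟨E, hE⟩ := TodaSurface.exists_JG2_le hb hδ hδ1 K₁ K₂ hh₁.continuous hh₂.continuous
      hpos₁ hpos₂ hp₁ hp₂
    filter_upwards [TodaSurface.eventually_mul_log_add_lt
      (c₁ := 2 * (4 * K₁ * (κ ^ 3 * Real.pi) - ρ₁))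
      (c₂ := 2 / 3 * (4 * K₂ * (κ ^ 3 * Real.pi) - ρ₂))
      (by linarith) (by linarith) E L, eventually_gt_atTop 0] with lam hL hlam ζ
    obtain ⟨s, t, x, t', x', hs, ht, hts, ht', hts', hx, hx', hphi⟩ := TodaSurface.exists_phi_eq ζ
    obtain ⟨e₁, e₂⟩ := hphi lam
    rw [TodaSurface.PhiG2, e₁, e₂]
    exact (hE _ _ t x t' x' (mul_nonneg hlam.le (sub_nonneg.2 hs.2)) (mul_nonneg hlam.le hs.1)
      ht hts ht' hts' fun k j => hsep _ (hx k) _ (hx' j)).trans_lt (hL s hs)
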